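/- Let $\{L_n\}_{n\ge1}$ be a strictly increasing sequence of natural numbers and $\{k_n\}_{n\ge1}$ a sequence of natural numbers with $k_n\ge2$ for all $n$. Let $\Gamma$ be a rooted tree of type $\{L_n,k_n\}$, i.e. a tree with root $O$ in which every vertex at distance $j$ from $O$ has exactly $\kappa_j$ neighbors at distance $j+1$ from $O$, where $\kappa_j=k_n$ if $j=L_n$ for some $n\ge1$ and $\kappa_j=1$ otherwise. Assume that $\Gamma$ is sparse: $L_{n+1}-L_n\to\infty$ as $n\to\infty$. Let $\Delta$ be the Laplacian of $\Gamma$, i.e. the closure in $\ell^2(\Gamma)$ of the operator $$(\Delta f)(x)=\sum_{y:\,d(x,y)=1}f(y)$$ defined on the finitely supported functions. Let $J_0$ be the Jacobi matrix with zero diagonal, $$J_0=\begin{pmatrix}0&a(1)&0&\\a(1)&0&a(2)&\ddots\\0&a(2)&0&\ddots\\&\ddots&\ddots&\ddots\end{pmatrix},\qquad a(j)=\begin{cases}\sqrt{k_m}& j=L_m+1\text{ for some }m\ge1,\\1&\text{otherwise,}\end{cases}$$ regarded as the operator in $\ell^2(\mathbb Z^+)$ that is the closure of its restriction to finitely supported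 sequences. For a closed densely defined operator $A$ let $\sigma_{\mathrm{ess}}(A)$ denote the set of all $z\in\mathbb C$ such that $A-z$ is not Fredholm (does not have a finite-dimensional kernel and a closed range of finite codimension); for self-adjoint $A$ this is the spectrum of $A$ without the isolated eigenvalues of finite multiplicity. If either $k_n\to\infty$ or $\{k_n\}$ is bounded, then $$\sigma_{\mathrm{ess}}(\Delta)=\sigma_{\mathrm{ess}}(J_0).$$ -/

import Mathlib

open Filter Topology

noncomputable section

/-! ### Spherically homogeneous rooted trees -/

/-- A pair of sequences `{L_n}`, `{k_n}`, `n ≥ 1`, of natural numbers with `L` strictly increasing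
and `k_n ≥ 2`.  The values `L 0` and `k 0` are never used. -/
structure IsBranchingData (L k : ℕ → ℕ) : Prop where
  strictMonoOn : StrictMonoOn L (Set.Ici 1)
  two_le : ∀ n, 1 ≤ n → 2 ≤ k n

open Classical in
/-- The branching numbers `κ_j`: `κ_j = k_n` if `j = L_n` for some `n ≥ 1`, and `κ_j = 1` otherwise.
(The index `n` is unique when `L` is strictly increasing.) -/
def branching (L k : ℕ → ℕ) (j : ℕ) : ℕ :=
  if h : ∃ n, 1 ≤ n ∧ L n = j then k h.choose else 1

/-- The graph `G` with root `O` is a spherically homogeneous rooted tree with branching numbers `κ`: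
it is a tree, and each vertex `v` of generation `j = d(O, v)` is connected with exactly `κ j`
vertices of generation `j + 1`. -/
structure IsSphericallyHomogeneous {V : Type*} (G : SimpleGraph V) (O : V) (κ : ℕ → ℕ) : Prop where
  isTree : G.IsTree
  encard_children : ∀ v : V,
    {w : V | G.Adj v w ∧ G.dist O w = G.dist O v + 1}.encard = (κ (G.dist O v) : ℕ∞)

/-- `(G, O)` is a spherically homogeneous rooted tree of type `{L_n, k_n}`. -/
structure IsSHTreeOfType {V : Type*} (G : SimpleGraph V) (O : V) (L k : ℕ → ℕ) : Prop where
  data : IsBranchingData L k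
  homogeneous : IsSphericallyHomogeneous G O (branching L k)

/-- A spherically homogeneous rooted tree of type `{L_n, k_n}` that is sparse:
`L_{n+1} - L_n → ∞`. -/
structure IsSparseTree {V : Type*} (G : SimpleGraph V) (O : V) (L k : ℕ → ℕ) : Prop where
  ofType : IsSHTreeOfType G O L k
  sparse : Tendsto (fun n => L (n + 1) - L n) atTop atTop

/-! ### Operators on `ℓ²` -/

/-- The complex Hilbert space `ℓ²(ι)`. -/
abbrev EllTwo (ι : Type*) : Type _ := lp (fun _ : ι => ℂ) 2

/-- The finitely supported elements of `ℓ²(ι)`. -/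
def finSupported (ι : Type*) : Submodule ℂ (EllTwo ι) where
  carrier := {u | (Function.support (u : ι → ℂ)).Finite}
  zero_mem' := by
    show (Function.support ((0 : EllTwo ι) : ι → ℂ)).Finite
    rw [lp.coeFn_zero, Function.support_zero]
    exact Set.finite_empty
  add_mem' := by
    intro u v hu hv
    exact (hu.union hv).subset (by
      rw [lp.coeFn_add]; exact Function.support_add _ _)
  smul_mem' := by
    intro c u hu
    exact hu.subset (by
      rw [lp.coeFn_smul]; exact Function.support_const_smul_subset c _)

/-- A finitely supported function is square summable. -/
theorem memℓp_of_finite_support {ι : Type*} {f : ι → ℂ} (hf : (Function.support f).Finite) :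
    Memℓp f 2 :=
  (memℓp_zero (by simpa [Function.support] using hf)).of_exponent_ge zero_le

/-- The restriction to the finitely supported elements of `ℓ²(ι)` of a linear map `T` on all
functions that preserves finiteness of supports, as a partially defined operator in `ℓ²(ι)`. -/
def minimalOp {ι : Type*} (T : (ι → ℂ) →ₗ[ℂ] (ι → ℂ))
    (hT : ∀ f, (Function.support f).Finite → (Function.support (T f)).Finite) :
    EllTwo ι →ₗ.[ℂ] EllTwo ι where
  domain := finSupported ι
  toFun :=
    { toFun := fun u => ⟨T (u : EllTwo ι), memℓp_of_finite_support (hT _ u.2)⟩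
      map_add' := fun u v => Subtype.ext
        (map_add T ((u : EllTwo ι) : ι → ℂ) ((v : EllTwo ι) : ι → ℂ))
      map_smul' := fun c u => Subtype.ext (map_smul T c ((u : EllTwo ι) : ι → ℂ)) }

/-! ### The Laplacian of a locally finite graph -/

/-- The formal Laplacian `(Δ f)(x) = ∑_{y : d(x,y) = 1} f(y)` on all functions on the vertices. -/
def formalLaplacian {V : Type*} (G : SimpleGraph V) [G.LocallyFinite] :
    (V → ℂ) →ₗ[ℂ] (V → ℂ) where
  toFun f x := ∑ y ∈ G.neighborFinset x, f y
  map_add' f g := by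
    ext x
    simp [Finset.sum_add_distrib]
  map_smul' c f := by
    ext x
    simp [Finset.mul_sum]

theorem formalLaplacian_support {V : Type*} (G : SimpleGraph V) [G.LocallyFinite] (f : V → ℂ)
    (hf : (Function.support f).Finite) : (Function.support (formalLaplacian G f)).Finite := by
  refine (hf.biUnion (t := fun y => (G.neighborFinset y : Set V))
    (fun y _ => Finset.finite_toSet _)).subset ?_
  intro x hx
  obtain ⟨y, hy, hfy⟩ := Finset.exists_ne_zero_of_sum_ne_zero (show
    ∑ y ∈ G.neighborFinset x, f y ≠ 0 from hx)
  refine Set.mem_biUnion (show y ∈ Function.support f from hfy) ?_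
  simpa [SimpleGraph.adj_comm] using hy

/-- The Laplacian `Δ` in `ℓ²(V)`: the closure of the formal Laplacian restricted to the finitely
supported functions. (That restriction is densely defined and symmetric, hence closable.) -/
def laplacian {V : Type*} (G : SimpleGraph V) [G.LocallyFinite] : EllTwo V →ₗ.[ℂ] EllTwo V :=
  (minimalOp (formalLaplacian G) (formalLaplacian_support G)).closure

/-! ### Jacobi matrices -/

/-- The action of the semi-infinite Jacobi matrix `J({a(j)}_{j ≥ 1}, {b(j)}_{j ≥ 1})` with diagonal
entries `b(1), b(2), …` and off-diagonal entries `a(1), a(2), …`.  A function on the sites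
`1, 2, 3, …` is stored as a function on `ℕ`, its value at site `i + 1` being `u i`.
The values `a 0` and `b 0` are never used. -/
def formalJacobi (a b : ℕ → ℝ) : (ℕ → ℂ) →ₗ[ℂ] (ℕ → ℂ) where
  toFun u := fun
    | 0 => (b 1 : ℂ) * u 0 + (a 1 : ℂ) * u 1
    | i + 1 => (a (i + 1) : ℂ) * u i + (b (i + 2) : ℂ) * u (i + 1) + (a (i + 2) : ℂ) * u (i + 2)
  map_add' u v := by
    ext i
    cases i <;> simp <;> ring
  map_smul' c u := by
    ext i
    cases i <;> simp <;> ring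

theorem formalJacobi_support (a b : ℕ → ℝ) (u : ℕ → ℂ) (hu : (Function.support u).Finite) :
    (Function.support (formalJacobi a b u)).Finite := by
  obtain ⟨N, hN⟩ := hu.bddAbove
  have h0 : ∀ j, N < j → u j = 0 := by
    intro j hj
    by_contra h
    exact absurd (hN h) (by omega)
  refine (Set.finite_Iic (N + 1)).subset ?_
  intro i hi
  by_contra hlt
  simp only [Set.mem_Iic, not_le] at hlt
  apply hi
  cases i with
  | zero => omega
  | succ i =>
    show (a (i + 1) : ℂ) * u i + (b (i + 2) : ℂ) * u (i + 1) + (a (i + 2) : ℂ) * u (i + 2) = 0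
    rw [h0 i (by omega), h0 (i + 1) (by omega), h0 (i + 2) (by omega)]
    simp

/-- The operator in `ℓ²(ℤ⁺)` of the Jacobi matrix `J({a(j)}, {b(j)})`: the closure of its action on
finitely supported sequences. -/
def jacobi (a b : ℕ → ℝ) : EllTwo ℕ →ₗ.[ℂ] EllTwo ℕ :=
  (minimalOp (formalJacobi a b) (formalJacobi_support a b)).closure

/-- `R_0 = 0` and `R_n = L_n + 1` for `n ≥ 1`. -/
def startGen (L : ℕ → ℕ) : ℕ → ℕ
  | 0 => 0
  | n + 1 => L (n + 1) + 1

open Classical in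
/-- `a_n(j) = √k_m` if `j = R_m - R_n` for some `m > n`, and `a_n(j) = 1` otherwise. -/
def treeOffDiag (L k : ℕ → ℕ) (n j : ℕ) : ℝ :=
  if h : ∃ m, n < m ∧ startGen L m = startGen L n + j then √(k h.choose : ℝ) else 1

/-- The Jacobi matrix `J_n = J({a_n(j)}, {0})` in the decomposition of the Laplacian of a spherically
homogeneous rooted tree of type `{L_n, k_n}`. -/
def treeJacobi (L k : ℕ → ℕ) (n : ℕ) : EllTwo ℕ →ₗ.[ℂ] EllTwo ℕ :=
  jacobi (treeOffDiag L k n) (fun _ => 0)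

/-! ### The essential spectrum -/

/-- The operator `A - z`, as a linear map on the domain of `A`. -/
def subScalar {E : Type*} [AddCommGroup E] [Module ℂ E] (A : E →ₗ.[ℂ] E) (z : ℂ) :
    A.domain →ₗ[ℂ] E :=
  A.toFun - z • A.domain.subtype

/-- The essential spectrum of a closed, densely defined operator `A`: the set of all complex `z`
for which `A - z` is not a Fredholm operator, that is, it is not the case that `A - z` has
finite-dimensional kernel, closed range, and range of finite codimension.
(For self-adjoint `A` this is the spectrum of `A` with the isolated eigenvalues of finite
multiplicity removed.) -/
def essentialSpectrum {E : Type*} [NormedAddCommGroup E] [NormedSpace ℂ E] (A : E →ₗ.[ℂ] E) :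
    Set ℂ :=
  {z | ¬ (FiniteDimensional ℂ (LinearMap.ker (subScalar A z)) ∧
    IsClosed (LinearMap.range (subScalar A z) : Set E) ∧
    FiniteDimensional ℂ (E ⧸ LinearMap.range (subScalar A z)))}

end

/-!
The Laplacian `Δ` of a spherically homogeneous tree splits into Jacobi matrices, and the proof
works with an isometric, not necessarily surjective, form of this splitting. Let `κ j` be the number
of children of a vertex on level `j`. With the normalized sum `B` over the children (`childSum`)
and the difference `D` between a value and its mean over the siblings (`deviation`), each vertex `y`
gives a `component` of `f`: the sequence that is `(D Bⁱ f)(y)` on level `|y| + i` and `0` below `|y|`.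
The sum of the squared norms of the components is `‖f‖²` (`tsum_sqSum_component`), and on the levels
`≥ |y|` the component of `Δ f` is obtained from that of `f` by applying the Jacobi matrix `J = J₀`
(`component_laplacian`). So the component at `y` sees the truncation of `J` to the sites `≥ |y|`. It
vanishes unless `y` is the root or a child of a branching vertex. In the other direction, the radial
functions embed `J` isometrically into `Δ` (`laplacian_radial`).

Since levels or sites with coupling `1` occur arbitrarily far out, cutting off there shows that both
operators are the maximal ones, hence self-adjoint (`HasGoodCutoffs`). For a self-adjoint `A`, being
Fredholm at `z` amounts to a lower bound for `A - z` off a finite-dimensional space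
(`IsFredholmAt.exists_norm_sub_le` and `isFredholmAt_of_bound`); in particular it holds at non-real
`z`. Such a bound for `Δ` restricts to the radial functions.

Conversely, let `J` be Fredholm at a real `x`. Then `J - x` is bounded below on the sequences supported
far out (`exists_bound_of_tail`). For a vertex `y` far from the root, below a branching vertex,
sparsity provides a long free stretch starting at `y`. The truncation at `y` imposes a Dirichlet
condition, and the solution of the free equation with this condition is not square summable
(`le_sum_freeSolution_sq`, for every real `x`), so an approximate solution is small at `y`. Setting it to
`0` there gives an approximate solution for `J` itself at a small cost, and the truncations are bounded
below uniformly (`exists_uniform_bound`). At each of the finitely many vertices near the root, the bound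
holds if the component vanishes at its first site and is orthogonal to the kernel of `J - x`; these
conditions define a space of finite codimension, on which adding up the components gives the bound
for `Δ`.
-/

/-! ### Fredholm operators and lower bounds -/

/-- `A - z` is a Fredholm operator: the complement of the essential spectrum of `A`. -/
def IsFredholmAt {E : Type*} [NormedAddCommGroup E] [NormedSpace ℂ E] (A : E →ₗ.[ℂ] E)
    (z : ℂ) : Prop :=
  FiniteDimensional ℂ (LinearMap.ker (subScalar A z)) ∧
    IsClosed (LinearMap.range (subScalar A z) : Set E) ∧
    FiniteDimensional ℂ (E ⧸ LinearMap.range (subScalar A z))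

theorem subScalar_apply {E : Type*} [AddCommGroup E] [Module ℂ E] (A : E →ₗ.[ℂ] E) (z : ℂ)
    (u : A.domain) : subScalar A z u = A u - z • (u : E) := rfl

section Abstract

variable {E : Type*} [NormedAddCommGroup E] [InnerProductSpace ℂ E]

/-- The map `(u, w) ↦ w - z u` on `E × E`; on the graph of `A` its range is that of `A - z`. -/
def graphSub (E : Type*) [NormedAddCommGroup E] [InnerProductSpace ℂ E] (z : ℂ) :
    E × E →L[ℂ] E :=
  ContinuousLinearMap.snd ℂ E E - z • ContinuousLinearMap.fst ℂ E E

theorem range_subScalar_eq_map_graph (A : E →ₗ.[ℂ] E) (z : ℂ) :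
    LinearMap.range (subScalar A z) = A.graph.map (graphSub E z).toLinearMap := by
  ext y
  simp only [LinearMap.mem_range, Submodule.mem_map, Prod.exists]
  constructor
  · rintro ⟨u, rfl⟩
    exact ⟨u, A u, A.mem_graph u, rfl⟩
  · rintro ⟨u, w, h, rfl⟩
    obtain ⟨v, hv, hw⟩ := (LinearPMap.mem_graph_iff A).1 h
    simp only at hv hw
    exact ⟨v, by rw [subScalar_apply, hv, hw]; rfl⟩

/-- If `A - z` is Fredholm, then `u` is approximated by an element of the finite-dimensional
kernel up to a multiple of `‖(A - z) u‖`. This is the open mapping theorem on the graph of `A`. -/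
theorem IsFredholmAt.exists_norm_sub_le [CompleteSpace E] {A : E →ₗ.[ℂ] E} (hA : A.IsClosed) {z : ℂ}
    (h : IsFredholmAt A z) :
    ∃ N : Submodule ℂ E, FiniteDimensional ℂ N ∧ ∃ C : ℝ, 0 < C ∧
      ∀ u w, (u, w) ∈ A.graph → ∃ v ∈ N, ‖u - v‖ ≤ C * ‖w - z • u‖ := by
  obtain ⟨hker, hran, -⟩ := h
  refine ⟨(LinearMap.ker (subScalar A z)).map A.domain.subtype, inferInstance, ?_⟩
  have : CompleteSpace A.graph := hA.completeSpace_coe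
  have : CompleteSpace (LinearMap.range (subScalar A z)) := hran.completeSpace_coe
  let φ : A.graph →L[ℂ] LinearMap.range (subScalar A z) :=
    ((graphSub E z).comp A.graph.subtypeL).codRestrict _ (fun p => by
      rw [range_subScalar_eq_map_graph]
      exact Submodule.mem_map_of_mem p.2)
  have hφ : Function.Surjective φ := by
    rintro ⟨y, hy⟩
    have hy' := hy
    rw [range_subScalar_eq_map_graph] at hy'
    obtain ⟨p, hp, hpy⟩ := hy'
    exact ⟨⟨p, hp⟩, Subtype.ext hpy⟩
  obtain ⟨C, hC, hpre⟩ := φ.exists_preimage_norm_le hφ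
  refine ⟨C, hC, fun u w huw => ?_⟩
  obtain ⟨⟨⟨u', w'⟩, hp⟩, hpe, hpn⟩ := hpre (φ ⟨(u, w), huw⟩)
  have he : w' - z • u' = w - z • u := congrArg Subtype.val hpe
  refine ⟨u - u', ?_, ?_⟩
  · have hd : (u - u', w - w') ∈ A.graph := A.graph.sub_mem huw hp
    obtain ⟨v, hv, hw⟩ := (LinearPMap.mem_graph_iff A).1 hd
    simp only at hv hw
    refine ⟨v, ?_, hv⟩
    rw [SetLike.mem_coe, LinearMap.mem_ker, subScalar_apply, hv, hw, smul_sub,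
      sub_sub_sub_comm, ← he, sub_self]
  · rw [sub_sub_cancel]
    calc ‖u'‖ ≤ ‖(u', w')‖ := norm_fst_le (u', w')
      _ ≤ C * ‖w - z • u‖ := hpn

/-- A self-adjoint `A` (closed, symmetric, with `(ran (A - z))ᗮ ⊆ ker (A - z̄)`) for which `A - z`
is bounded below on a closed subspace of finite codimension is Fredholm at `z`. -/
theorem isFredholmAt_of_bound [CompleteSpace E] {A : E →ₗ.[ℂ] E} (hA : A.IsClosed)
    (hsymm : ∀ u w u' w', (u, w) ∈ A.graph → (u', w') ∈ A.graph → inner ℂ w u' = inner ℂ u w')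
    {z : ℂ}
    (hadj : ∀ v, (∀ u w, (u, w) ∈ A.graph → inner ℂ v (w - z • u) = 0) →
      (v, (starRingEnd ℂ z) • v) ∈ A.graph)
    {M : Submodule ℂ E} (hMc : IsClosed (M : Set E)) (hM : M.CoFG) {c : ℝ} (hc : 0 < c)
    (hbound : ∀ u w, (u, w) ∈ A.graph → u ∈ M → c * ‖u‖ ≤ ‖w - z • u‖) :
    IsFredholmAt A z := by
  have hker : FiniteDimensional ℂ (LinearMap.ker (subScalar A z)) := by
    let f : LinearMap.ker (subScalar A z) →ₗ[ℂ] E ⧸ M :=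
      M.mkQ ∘ₗ A.domain.subtype ∘ₗ (LinearMap.ker (subScalar A z)).subtype
    have : FiniteDimensional ℂ (E ⧸ M) := hM
    refine FiniteDimensional.of_injective f ?_
    rw [← LinearMap.ker_eq_bot, LinearMap.ker_eq_bot']
    rintro ⟨u, hu⟩ hfu
    have huM : (u : E) ∈ M := (Submodule.Quotient.mk_eq_zero M).1 hfu
    have h1 := hbound u (A u) (A.mem_graph u) huM
    rw [← subScalar_apply, LinearMap.mem_ker.1 hu, norm_zero] at h1
    have h2 : ‖(u : E)‖ = 0 := le_antisymm (by nlinarith [norm_nonneg (u : E)]) (norm_nonneg _)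
    exact Subtype.ext (Subtype.ext (norm_eq_zero.1 h2))
  have hran : IsClosed (LinearMap.range (subScalar A z) : Set E) := by
    let GM : Submodule ℂ (E × E) := A.graph ⊓ M.comap (LinearMap.fst ℂ E E)
    have hGMc : IsClosed (GM : Set (E × E)) := hA.inter (hMc.preimage continuous_fst)
    have : CompleteSpace GM := hGMc.completeSpace_coe
    let φ : GM →L[ℂ] E := (graphSub E z).comp GM.subtypeL
    have hφc : IsClosed (Set.range φ) := by
      -- On the graph, `‖w‖ ≤ ‖w - z u‖ + |z| ‖u‖` turns the bound into one for `‖(u, w)‖`.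
      have hanti : AntilipschitzWith (1 + (1 + ‖z‖₊) * (⟨c, hc.le⟩⁻¹)) φ := by
        refine φ.antilipschitz_of_bound fun p => ?_
        obtain ⟨⟨u, w⟩, hp1, hp2⟩ := p
        have h1 : c * ‖u‖ ≤ ‖w - z • u‖ := hbound u w hp1 hp2
        have h2 : ‖u‖ ≤ c⁻¹ * ‖w - z • u‖ := by
          rw [inv_mul_eq_div, le_div_iff₀ hc]; linarith
        have h3 : ‖w‖ ≤ ‖w - z • u‖ + ‖z‖ * ‖u‖ := by
          rw [← norm_smul]; exact norm_le_norm_sub_add w (z • u)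
        have h4 := norm_nonneg (w - z • u)
        have h5 := mul_le_mul_of_nonneg_left h2 (norm_nonneg z)
        have h6 : 0 ≤ c⁻¹ * ‖w - z • u‖ := by positivity
        have h7 : 0 ≤ ‖z‖ * (c⁻¹ * ‖w - z • u‖) := by positivity
        change max ‖u‖ ‖w‖ ≤ (1 + (1 + ‖z‖) * c⁻¹) * ‖w - z • u‖
        apply max_le <;> nlinarith
      exact hanti.isClosed_range φ.uniformContinuous
    -- The part of the graph over `M` has a finite-dimensional complement in the graph.
    have hsup : ∃ F : Submodule ℂ (E × E), FiniteDimensional ℂ F ∧ A.graph = GM ⊔ F := by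
      let P := M.comap ((LinearMap.fst ℂ E E) ∘ₗ A.graph.subtype)
      have hP : FiniteDimensional ℂ (A.graph ⧸ P) := by
        have : FiniteDimensional ℂ (E ⧸ M) := hM
        refine FiniteDimensional.of_injective
          (P.mapQ M ((LinearMap.fst ℂ E E) ∘ₗ A.graph.subtype) le_rfl) ?_
        rw [← LinearMap.ker_eq_bot, Submodule.ker_mapQ]
        exact Submodule.mkQ_map_self P
      obtain ⟨Q, hQ⟩ := P.exists_isCompl
      have : FiniteDimensional ℂ Q :=
        LinearEquiv.finiteDimensional (P.quotientEquivOfIsCompl Q hQ)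
      refine ⟨Q.map A.graph.subtype, inferInstance, ?_⟩
      have h1 : GM = P.map A.graph.subtype := by
        ext p
        simp [GM, P, and_comm]
      rw [h1, ← Submodule.map_sup, hQ.sup_eq_top, Submodule.map_top, Submodule.range_subtype]
    obtain ⟨F, hF, hGF⟩ := hsup
    rw [range_subScalar_eq_map_graph, hGF, Submodule.map_sup]
    refine Submodule.isClosed_sup_finiteDimensional _ _ ?_
    convert hφc using 1
    ext y
    simp [φ]
  refine ⟨hker, hran, ?_⟩
  have : CompleteSpace (LinearMap.range (subScalar A z)) := hran.completeSpace_coe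
  have hperp : FiniteDimensional ℂ (LinearMap.range (subScalar A z))ᗮ := by
    refine Submodule.finiteDimensional_of_le
      (S₂ := (LinearMap.ker (subScalar A z)).map A.domain.subtype) fun v hv => ?_
    have hvg := hadj v fun u w huw => by
      rw [Submodule.mem_orthogonal'] at hv
      refine hv _ ?_
      rw [range_subScalar_eq_map_graph]
      exact Submodule.mem_map_of_mem (f := (graphSub E z).toLinearMap) huw
    have hs := hsymm _ _ _ _ hvg hvg
    rw [inner_smul_left, inner_smul_right, Complex.conj_conj] at hs
    -- By symmetry either `v = 0` or `z` is real; in both cases `A v = z v`.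
    have hv2 : (starRingEnd ℂ z) • v = z • v := by
      by_cases hv0 : v = 0
      · simp [hv0]
      · exact congrArg (· • v) (mul_right_cancel₀ (inner_self_ne_zero.2 hv0) hs).symm
    obtain ⟨x, hx, hAx⟩ := (LinearPMap.mem_graph_iff A).1 hvg
    simp only at hx hAx
    refine ⟨x, ?_, hx⟩
    rw [SetLike.mem_coe, LinearMap.mem_ker, subScalar_apply, hx, hAx, hv2, sub_self]
  exact LinearEquiv.finiteDimensional
    (Submodule.quotientEquivOrthogonal (𝕜 := ℂ) (LinearMap.range (subScalar A z))).symm.toLinearEquiv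

/-- A symmetric operator is bounded below by `|Im z|` at `z`. -/
theorem abs_im_mul_norm_le {A : E →ₗ.[ℂ] E}
    (hsymm : ∀ u w u' w', (u, w) ∈ A.graph → (u', w') ∈ A.graph → inner ℂ w u' = inner ℂ u w')
    (z : ℂ) {u w : E} (huw : (u, w) ∈ A.graph) : |z.im| * ‖u‖ ≤ ‖w - z • u‖ := by
  have h1 := hsymm _ _ _ _ huw huw
  have him : (inner ℂ u w : ℂ).im = 0 := by
    rw [← inner_conj_symm] at h1
    have := congrArg Complex.im h1
    rw [Complex.conj_im] at this
    linarith
  have h2 : (inner ℂ u (w - z • u) : ℂ).im = -(z.im * ‖u‖ ^ 2) := by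
    rw [inner_sub_right, inner_smul_right, inner_self_eq_norm_sq_to_K, Complex.sub_im, him,
      zero_sub]
    change -(z * (‖u‖ : ℂ) ^ 2).im = _
    rw [← Complex.ofReal_pow, Complex.im_mul_ofReal]
  have h3 : |z.im| * ‖u‖ ^ 2 ≤ ‖u‖ * ‖w - z • u‖ := by
    have h4 := (Complex.abs_im_le_norm _).trans (norm_inner_le_norm (𝕜 := ℂ) u (w - z • u))
    rwa [h2, abs_neg, abs_mul, abs_of_nonneg (sq_nonneg ‖u‖)] at h4
  by_cases hu : ‖u‖ = 0
  · rw [hu, mul_zero]; exact norm_nonneg _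
  · have hpos : 0 < ‖u‖ := lt_of_le_of_ne (norm_nonneg u) (Ne.symm hu)
    nlinarith

end Abstract

/-! ### Square sums -/

section SquareSums

open scoped ENNReal

variable {ι : Type*}

/-- The sum of the squares of the absolute values of `f`, possibly infinite. -/
noncomputable def sqSum (f : ι → ℂ) : ℝ≥0∞ := ∑' x, ‖f x‖ₑ ^ 2

theorem memℓp_two_iff_sqSum {f : ι → ℂ} : Memℓp f 2 ↔ sqSum f ≠ ∞ := by
  have h1 : sqSum f = ∑' x, ((‖f x‖₊ ^ 2 : NNReal) : ℝ≥0∞) :=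
    tsum_congr fun x => by rw [ENNReal.coe_pow]; rfl
  rw [memℓp_gen_iff (by simp), h1, ENNReal.tsum_coe_ne_top_iff_summable, ← NNReal.summable_coe]
  simp

theorem sqSum_coe (u : EllTwo ι) : sqSum (u : ι → ℂ) = ENNReal.ofReal (‖u‖ ^ 2) := by
  have h1 := lp.hasSum_norm (p := 2) (by simp) u
  simp only [ENNReal.toReal_ofNat, Real.rpow_ofNat] at h1
  rw [← h1.tsum_eq, ENNReal.ofReal_tsum_of_nonneg (fun x => sq_nonneg _) h1.summable]
  refine tsum_congr fun x => ?_
  rw [ENNReal.ofReal_pow (norm_nonneg _), ofReal_norm]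

theorem sqSum_coe_ne_top (u : EllTwo ι) : sqSum (u : ι → ℂ) ≠ ∞ :=
  memℓp_two_iff_sqSum.1 (lp.memℓp u)

theorem norm_sq_eq_toReal_sqSum (u : EllTwo ι) : ‖u‖ ^ 2 = (sqSum (u : ι → ℂ)).toReal := by
  rw [sqSum_coe, ENNReal.toReal_ofReal (sq_nonneg _)]

theorem norm_lt_of_sqSum_lt {u : EllTwo ι} {ε : ℝ} (hε : 0 < ε)
    (h : sqSum (u : ι → ℂ) < ENNReal.ofReal (ε ^ 2)) : ‖u‖ < ε := by
  rw [sqSum_coe, ENNReal.ofReal_lt_ofReal_iff (by positivity)] at h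
  exact lt_of_pow_lt_pow_left₀ 2 hε.le h

theorem sqSum_mono {f g : ι → ℂ} (h : ∀ x, ‖f x‖ ≤ ‖g x‖) : sqSum f ≤ sqSum g :=
  ENNReal.tsum_le_tsum fun x => by
    gcongr
    exact enorm_le_iff_norm_le.2 (h x)

/-- The restriction of a function on `ι`, graded by `gen : ι → ℕ`, to the levels up to `n`. -/
def cutoff (gen : ι → ℕ) (n : ℕ) (f : ι → ℂ) : ι → ℂ := fun x => if gen x ≤ n then f x else 0

/-- The restriction of a function on `ι`, graded by `gen : ι → ℕ`, to the levels from `n` on. -/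
def tail (gen : ι → ℕ) (n : ℕ) (f : ι → ℂ) : ι → ℂ := fun x => if n ≤ gen x then f x else 0

theorem tendsto_sqSum_tail (gen : ι → ℕ) {f : ι → ℂ}
    (hf : sqSum f ≠ ∞) : Tendsto (fun n => sqSum (tail gen n f)) atTop (𝓝 0) := by
  have h1 := ENNReal.tendsto_tsum_compl_atTop_zero hf
  rw [ENNReal.tendsto_nhds_zero] at h1 ⊢
  intro ε hε
  obtain ⟨s, hs⟩ := (h1 ε hε).exists
  filter_upwards [eventually_ge_atTop (s.sup gen + 1)] with n hn
  refine le_trans ?_ hs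
  have h2 : ∑' b : {x // x ∉ s}, ‖f b‖ₑ ^ 2 =
      ∑' x, Set.indicator {x | x ∉ s} (fun x => ‖f x‖ₑ ^ 2) x :=
    tsum_subtype {x | x ∉ s} (fun x => ‖f x‖ₑ ^ 2)
  rw [h2]
  refine ENNReal.tsum_le_tsum fun x => ?_
  by_cases hx : n ≤ gen x
  · have : x ∉ s := fun hxs => by
      have := Finset.le_sup (f := gen) hxs
      omega
    rw [Set.indicator_of_mem (s := {x | x ∉ s}) this, tail, if_pos hx]
  · simp [tail, hx]

end SquareSums

/-! ### Self-adjointness of local operators with good cutoffs -/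

section LocalOperators

open scoped ENNReal

variable {ι : Type*}

open Classical in
/-- The image `T δ_x` of a basis vector as an element of `ℓ²(ι)`. -/
noncomputable def applySingle (T : (ι → ℂ) →ₗ[ℂ] (ι → ℂ))
    (hT : ∀ f, (Function.support f).Finite → (Function.support (T f)).Finite) (x : ι) : EllTwo ι :=
  ⟨T (Pi.single x 1), memℓp_of_finite_support (hT _ ((Set.finite_singleton x).subset
    Pi.support_single_subset))⟩

/-- A formally symmetric local operator `T` on functions on a set graded by `gen` which, for
infinitely many `n`, commutes with the cutoff at level `n` up to an error controlled by the values
of the function on the levels `≥ n`. -/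
structure HasGoodCutoffs (T : (ι → ℂ) →ₗ[ℂ] (ι → ℂ))
    (hT : ∀ f, (Function.support f).Finite → (Function.support (T f)).Finite)
    (gen : ι → ℕ) : Prop where
  finite_le : ∀ n, {x | gen x ≤ n}.Finite
  inner_applySingle : ∀ x (f : EllTwo ι), inner ℂ (applySingle T hT x) f = T f x
  exists_cutoff : ∀ N, ∃ n, N ≤ n ∧ ∀ f : ι → ℂ,
    sqSum (T (cutoff gen n f) - cutoff gen n (T f)) ≤ sqSum (tail gen n f)

namespace HasGoodCutoffs

variable {T : (ι → ℂ) →ₗ[ℂ] (ι → ℂ)}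
  {hT : ∀ f, (Function.support f).Finite → (Function.support (T f)).Finite} {gen : ι → ℕ}

/-- The graph of the maximal operator `{(u, w) | T u = w}` in `ℓ²(ι)`. -/
def maximalGraph (T : (ι → ℂ) →ₗ[ℂ] (ι → ℂ)) : Submodule ℂ (EllTwo ι × EllTwo ι) where
  carrier := {p | T (p.1 : ι → ℂ) = (p.2 : ι → ℂ)}
  zero_mem' := map_zero T
  add_mem' := by
    intro p q hp hq
    change T ((p.1 : ι → ℂ) + (q.1 : ι → ℂ)) = (p.2 : ι → ℂ) + (q.2 : ι → ℂ)
    rw [map_add, Set.mem_ofPred.1 hp, Set.mem_ofPred.1 hq]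
  smul_mem' := by
    intro c p hp
    change T (c • (p.1 : ι → ℂ)) = c • (p.2 : ι → ℂ)
    rw [map_smul, Set.mem_ofPred.1 hp]

theorem mem_maximalGraph {u w : EllTwo ι} :
    (u, w) ∈ maximalGraph T ↔ T (u : ι → ℂ) = (w : ι → ℂ) := Iff.rfl

theorem isClosed_maximalGraph (h : HasGoodCutoffs T hT gen) :
    IsClosed (maximalGraph T : Set (EllTwo ι × EllTwo ι)) := by
  have h1 : (maximalGraph T : Set (EllTwo ι × EllTwo ι)) =
      ⋂ x, {p | inner ℂ (applySingle T hT x) p.1 = lp.evalCLM ℂ (fun _ : ι => ℂ) 2 x p.2} := by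
    ext p
    simp only [Set.mem_iInter, Set.mem_ofPred_eq, h.inner_applySingle]
    exact funext_iff
  rw [h1]
  exact isClosed_iInter fun x => isClosed_eq (by fun_prop) (by fun_prop)

theorem graph_minimalOp_le : (minimalOp T hT).graph ≤ maximalGraph T := by
  rintro ⟨u, w⟩ hp
  obtain ⟨v, hv, hw⟩ := (LinearPMap.mem_graph_iff _).1 hp
  simp only at hv hw
  rw [mem_maximalGraph, ← hv, ← hw]
  rfl

/-- Cutoffs approximate the maximal operator by its restriction to finite supports. -/
theorem maximalGraph_le (h : HasGoodCutoffs T hT gen) :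
    maximalGraph T ≤ (minimalOp T hT).graph.topologicalClosure := by
  rintro ⟨u, w⟩ huw
  rw [mem_maximalGraph] at huw
  change (u, w) ∈ closure ((minimalOp T hT).graph : Set (EllTwo ι × EllTwo ι))
  rw [Metric.mem_closure_iff]
  intro ε hε
  have hu0 := tendsto_sqSum_tail gen (sqSum_coe_ne_top u)
  have hw0 := tendsto_sqSum_tail gen (sqSum_coe_ne_top w)
  have hpos : (0 : ℝ≥0∞) < ENNReal.ofReal ((ε / 2) ^ 2) := by
    rw [ENNReal.ofReal_pos]; positivity
  obtain ⟨N, hN⟩ := eventually_atTop.1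
    ((hu0.eventually_lt_const hpos).and (hw0.eventually_lt_const hpos))
  obtain ⟨n, hn, hcut⟩ := h.exists_cutoff N
  have hsup : ∀ f : ι → ℂ, (Function.support (cutoff gen n f)).Finite := fun f =>
    (h.finite_le n).subset fun x hx => by
      by_contra hlt
      exact hx (if_neg hlt)
  let u' : EllTwo ι := ⟨cutoff gen n u, memℓp_of_finite_support (hsup _)⟩
  let w' : EllTwo ι := ⟨cutoff gen n w, memℓp_of_finite_support (hsup _)⟩
  let v' : EllTwo ι := ⟨T (cutoff gen n u), memℓp_of_finite_support (hT _ (hsup _))⟩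
  have hle : ∀ f : ι → ℂ, sqSum (f - cutoff gen n f) ≤ sqSum (tail gen n f) := fun f =>
    sqSum_mono fun x => by
      rw [Pi.sub_apply, cutoff, tail]
      split_ifs <;> first | omega | simp
  have h1 : ‖u - u'‖ < ε / 2 := by
    refine norm_lt_of_sqSum_lt (by positivity) ?_
    rw [lp.coeFn_sub]
    exact (hle _).trans_lt (hN n hn).1
  have h2 : ‖w - w'‖ < ε / 2 := by
    refine norm_lt_of_sqSum_lt (by positivity) ?_
    rw [lp.coeFn_sub]
    exact (hle _).trans_lt (hN n hn).2
  have h3 : ‖v' - w'‖ < ε / 2 := by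
    refine norm_lt_of_sqSum_lt (by positivity) ?_
    rw [lp.coeFn_sub]
    refine lt_of_le_of_lt ?_ (hN n hn).1
    have := hcut u
    rwa [huw] at this
  refine ⟨(u', v'), ?_, ?_⟩
  · exact (minimalOp T hT).mem_graph ⟨u', hsup _⟩
  · rw [Prod.dist_eq, dist_eq_norm, dist_eq_norm]
    refine max_lt (by linarith) ?_
    have : w - v' = (w - w') - (v' - w') := by abel
    change ‖w - v'‖ < ε
    rw [this]
    linarith [norm_sub_le (w - w') (v' - w')]

theorem isClosable (h : HasGoodCutoffs T hT gen) : (minimalOp T hT).IsClosable := by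
  refine LinearPMap.IsClosed.isClosable (f := (maximalGraph T).toLinearPMap) ?_
    |>.leIsClosable ?_
  all_goals
    have h1 : (maximalGraph T).toLinearPMap.graph = maximalGraph T := by
      refine Submodule.toLinearPMap_graph_eq _ ?_
      rintro ⟨u, w⟩ huw hu
      simp only at hu
      rw [mem_maximalGraph, hu] at huw
      exact lp.ext (huw.symm.trans (map_zero T))
  · rw [LinearPMap.IsClosed, h1]
    exact h.isClosed_maximalGraph
  · rw [← LinearPMap.le_graph_iff, h1]
    exact graph_minimalOp_le

theorem graph_closure (h : HasGoodCutoffs T hT gen) :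
    (minimalOp T hT).closure.graph = maximalGraph T := by
  rw [← h.isClosable.graph_closure_eq_closure_graph]
  exact le_antisymm (Submodule.topologicalClosure_minimal _ graph_minimalOp_le
    h.isClosed_maximalGraph) h.maximalGraph_le

theorem mem_graph_closure (h : HasGoodCutoffs T hT gen) {u w : EllTwo ι} :
    (u, w) ∈ (minimalOp T hT).closure.graph ↔ T (u : ι → ℂ) = (w : ι → ℂ) := by
  rw [h.graph_closure, mem_maximalGraph]

theorem symmetric_closure (h : HasGoodCutoffs T hT gen) (u w u' w' : EllTwo ι)
    (huw : (u, w) ∈ (minimalOp T hT).closure.graph)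
    (huw' : (u', w') ∈ (minimalOp T hT).closure.graph) : inner ℂ w u' = inner ℂ u w' := by
  classical
  rw [h.mem_graph_closure] at huw'
  rw [← h.isClosable.graph_closure_eq_closure_graph] at huw
  have hcl : IsClosed {p : EllTwo ι × EllTwo ι | inner ℂ p.2 u' = inner ℂ p.1 w'} :=
    isClosed_eq (by fun_prop) (by fun_prop)
  refine closure_minimal ?_ hcl huw
  rintro ⟨v, y⟩ hp
  obtain ⟨x, hx, hy⟩ := (LinearPMap.mem_graph_iff _).1 hp
  simp only at hx hy
  have hfin : (Function.support (v : ι → ℂ)).Finite := hx ▸ x.2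
  have hv : v = ∑ i ∈ hfin.toFinset, (v i) • lp.single 2 i (1 : ℂ) := by
    refine lp.ext (funext fun j => ?_)
    rw [lp.coeFn_sum, Finset.sum_apply]
    simp only [lp.coeFn_smul, Pi.smul_apply, lp.single_apply, smul_eq_mul]
    by_cases hj : v j = 0
    · rw [hj, Finset.sum_eq_zero]
      intro i hi
      by_cases hij : i = j
      · rw [hij, hj, zero_mul]
      · rw [Pi.single_eq_of_ne' hij, mul_zero]
    · rw [Finset.sum_eq_single j (fun i _ hij => by rw [Pi.single_eq_of_ne' hij, mul_zero])
        (fun h => absurd (hfin.mem_toFinset.2 hj) h), Pi.single_eq_same, mul_one]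
  have hTv : T (v : ι → ℂ) = (y : ι → ℂ) := graph_minimalOp_le hp
  have hy' : y = ∑ i ∈ hfin.toFinset, (v i) • applySingle T hT i := by
    refine lp.ext ?_
    rw [← hTv]
    conv_lhs => rw [hv]
    rw [lp.coeFn_sum, lp.coeFn_sum, map_sum]
    refine Finset.sum_congr rfl fun i _ => ?_
    rw [lp.coeFn_smul, lp.coeFn_smul, map_smul, lp.coeFn_single]
    congr
  change inner ℂ y u' = inner ℂ v w'
  conv_rhs => rw [hv]
  rw [hy', sum_inner, sum_inner]
  refine Finset.sum_congr rfl fun i _ => ?_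
  rw [inner_smul_left, inner_smul_left, h.inner_applySingle, lp.inner_single_left, huw']
  simp

theorem mem_graph_of_orthogonal (h : HasGoodCutoffs T hT gen) {z : ℂ} {v : EllTwo ι}
    (hv : ∀ u w, (u, w) ∈ (minimalOp T hT).closure.graph → inner ℂ v (w - z • u) = 0) :
    (v, (starRingEnd ℂ z) • v) ∈ (minimalOp T hT).closure.graph := by
  classical
  rw [h.mem_graph_closure]
  funext x
  have h1 := hv (lp.single 2 x (1 : ℂ)) (applySingle T hT x) (by
    rw [h.mem_graph_closure, lp.coeFn_single]
    simp only [applySingle])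
  rw [inner_sub_right, inner_smul_right, lp.inner_single_right, sub_eq_zero,
    ← inner_conj_symm, h.inner_applySingle] at h1
  have h2 := congrArg (starRingEnd ℂ) h1
  rw [Complex.conj_conj] at h2
  rw [h2, lp.coeFn_smul, Pi.smul_apply]
  simp

theorem exists_norm_sub_le (h : HasGoodCutoffs T hT gen) {z : ℂ}
    (hF : IsFredholmAt (minimalOp T hT).closure z) :
    ∃ N : Submodule ℂ (EllTwo ι), FiniteDimensional ℂ N ∧ ∃ C : ℝ, 0 < C ∧
      ∀ u w : EllTwo ι, T (u : ι → ℂ) = (w : ι → ℂ) → ∃ v ∈ N, ‖u - v‖ ≤ C * ‖w - z • u‖ := by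
  obtain ⟨N, hN, C, hC, hle⟩ := hF.exists_norm_sub_le h.isClosable.closure_isClosed
  exact ⟨N, hN, C, hC, fun u w huw => hle u w (h.mem_graph_closure.2 huw)⟩

theorem isFredholmAt_of_bound (h : HasGoodCutoffs T hT gen) {z : ℂ}
    {M : Submodule ℂ (EllTwo ι)} (hMc : IsClosed (M : Set (EllTwo ι))) (hM : M.CoFG)
    {c : ℝ} (hc : 0 < c)
    (hbound : ∀ u w : EllTwo ι, T (u : ι → ℂ) = (w : ι → ℂ) → u ∈ M → c * ‖u‖ ≤ ‖w - z • u‖) :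
    IsFredholmAt (minimalOp T hT).closure z :=
  _root_.isFredholmAt_of_bound h.isClosable.closure_isClosed h.symmetric_closure
    (fun _ hv => h.mem_graph_of_orthogonal hv) hMc hM hc
    (fun u w huw => hbound u w (h.mem_graph_closure.1 huw))

theorem isFredholmAt_of_im_ne_zero (h : HasGoodCutoffs T hT gen) {z : ℂ} (hz : z.im ≠ 0) :
    IsFredholmAt (minimalOp T hT).closure z :=
  h.isFredholmAt_of_bound (M := ⊤) isClosed_univ Submodule.CoFG.top (abs_pos.2 hz)
    (fun _ _ huw _ => abs_im_mul_norm_le h.symmetric_closure z (h.mem_graph_closure.2 huw))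

end HasGoodCutoffs

end LocalOperators

/-! ### Parents and children in a spherically homogeneous tree -/

section Tree

open scoped ENNReal
open Finset (range)

theorem dist_root_eq_zero_iff {V : Type*} {G : SimpleGraph V} {O : V} (hG : G.IsTree) {x : V} :
    G.dist O x = 0 ↔ x = O := by
  rw [(hG.connected O x).dist_eq_zero_iff, eq_comm]

variable {V : Type*} (G : SimpleGraph V) [G.LocallyFinite] (O : V)

/-- The neighbours of `x` that are farther from the root than `x`. -/
noncomputable def children (x : V) : Finset V :=
  (G.neighborFinset x).filter fun y => G.dist O y = G.dist O x + 1

variable {G O} in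
theorem mem_children {x y : V} :
    y ∈ children G O x ↔ G.Adj x y ∧ G.dist O y = G.dist O x + 1 := by
  simp [children]

open Classical in
/-- The neighbour of `y` that is closer to the root than `y`; the root, which has none, is its own
parent by convention. -/
noncomputable def parent (y : V) : V :=
  if h : ∃ x, y ∈ children G O x then h.choose else y

variable {G O} {κ : ℕ → ℕ}

theorem card_children (h : IsSphericallyHomogeneous G O κ) (x : V) :
    (children G O x).card = κ (G.dist O x) := by
  have h1 := h.encard_children x
  have h2 : {w : V | G.Adj x w ∧ G.dist O w = G.dist O x + 1} = (children G O x : Set V) := by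
    ext w
    simp [mem_children]
  rw [h2, Set.encard_coe_eq_coe_finsetCard] at h1
  exact_mod_cast h1

theorem eq_of_mem_children (hG : G.IsTree) {x x' y : V} (hx : y ∈ children G O x)
    (hx' : y ∈ children G O x') : x = x' := by
  rw [mem_children] at hx hx'
  obtain ⟨q, hq, hql⟩ := (hG.connected O y).exists_path_of_dist
  -- A neighbour closer to the root precedes `y` on the unique path from the root.
  have key : ∀ v, G.Adj v y → G.dist O y = G.dist O v + 1 → v = q.penultimate := by
    intro v hv hd
    obtain ⟨p, hp, hpl⟩ := (hG.connected O v).exists_path_of_dist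
    refine hG.isAcyclic.eq_penultimate_of_adj_end hq hv.symm ?_
    refine hG.isAcyclic.mem_support_of_ne_mem_support_of_adj_of_isPath hq hp hv.symm ?_
    intro hy
    classical
    have h1 := SimpleGraph.dist_le (p.takeUntil y hy)
    have h2 := p.length_takeUntil_le_length hy
    omega
  rw [key x hx.1 hx.2, key x' hx'.1 hx'.2]

theorem exists_mem_children (hG : G.IsTree) {y : V} (hy : y ≠ O) : ∃ x, y ∈ children G O x := by
  obtain ⟨q, hq⟩ := (hG.connected O y).exists_walk_length_eq_dist
  have hnil : ¬ q.Nil := q.not_nil_of_ne hy.symm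
  have hadj : G.Adj q.penultimate y := q.adj_penultimate hnil
  refine ⟨q.penultimate, mem_children.2 ⟨hadj, ?_⟩⟩
  have h1 := SimpleGraph.dist_le q.dropLast
  have h2 : q.dropLast.length + 1 = q.length := by
    have := SimpleGraph.Walk.length_concat q.dropLast hadj
    rw [SimpleGraph.Walk.concat_dropLast] at this
    exact this.symm
  rcases hG.dist_eq_dist_add_one_of_adj O hadj with h3 | h3 <;> omega

theorem parent_eq (hG : G.IsTree) {x y : V} (hy : y ∈ children G O x) : parent G O y = x := by
  have h : ∃ x, y ∈ children G O x := ⟨x, hy⟩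
  rw [parent, dif_pos h]
  exact eq_of_mem_children hG h.choose_spec hy

theorem mem_children_parent (hG : G.IsTree) {y : V} (hy : y ≠ O) :
    y ∈ children G O (parent G O y) := by
  obtain ⟨x, hx⟩ := exists_mem_children hG hy
  rwa [parent_eq hG hx]

theorem dist_parent (hG : G.IsTree) {y : V} (hy : y ≠ O) :
    G.dist O y = G.dist O (parent G O y) + 1 :=
  (mem_children.1 (mem_children_parent hG hy)).2

theorem ne_root_of_mem_children {x y : V} (hy : y ∈ children G O x) : y ≠ O := by
  rintro rfl
  have := (mem_children.1 hy).2
  rw [SimpleGraph.dist_self] at this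
  omega

variable (G O) in
open Classical in
/-- The value of `f` at the parent, extended by `0` to the root. -/
noncomputable def atParent (f : V → ℂ) (x : V) : ℂ := if x = O then 0 else f (parent G O x)

theorem formalLaplacian_apply (hG : G.IsTree) (f : V → ℂ) (x : V) :
    formalLaplacian G f x = atParent G O f x + ∑ y ∈ children G O x, f y := by
  classical
  change ∑ y ∈ G.neighborFinset x, f y = _
  rw [← Finset.sum_filter_add_sum_filter_not _ (fun y => G.dist O y = G.dist O x + 1), add_comm]
  congr 1
  rw [atParent]
  split_ifs with hx
  · rw [Finset.filter_false_of_mem, Finset.sum_empty]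
    intro y hy
    rw [SimpleGraph.mem_neighborFinset] at hy
    subst hx
    rcases hG.dist_eq_dist_add_one_of_adj x hy with h3 | h3
    · rw [SimpleGraph.dist_self] at h3; omega
    · simpa using h3
  · have hp := mem_children.1 (mem_children_parent hG hx)
    rw [Finset.sum_eq_single (parent G O x)]
    · intro y hy hne
      rw [Finset.mem_filter, SimpleGraph.mem_neighborFinset] at hy
      rcases hG.dist_eq_dist_add_one_of_adj O hy.1 with h3 | h3
      · exact absurd (parent_eq hG (mem_children.2 ⟨hy.1.symm, h3⟩)).symm hne
      · exact absurd h3 hy.2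
    · intro hn
      refine absurd ?_ hn
      rw [Finset.mem_filter, SimpleGraph.mem_neighborFinset]
      exact ⟨hp.1.symm, by have := hp.2; omega⟩

/-- Every vertex other than the root is the child of exactly one vertex. -/
theorem tsum_eq_root_add_tsum_children (hG : G.IsTree) (F : V → ℝ≥0∞) :
    ∑' y, F y = F O + ∑' x, ∑ y ∈ children G O x, F y := by
  classical
  have h1 : ∀ y, F y = (if y = O then F O else 0) +
      ∑' x, if y ∈ children G O x then F y else 0 := by
    intro y
    by_cases hy : y = O
    · subst hy
      have : ∀ x, (if y ∈ children G y x then F y else 0) = 0 := fun x =>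
        if_neg fun hx => ne_root_of_mem_children hx rfl
      simp [this]
    · rw [if_neg hy, zero_add, tsum_eq_single (parent G O y),
        if_pos (mem_children_parent hG hy)]
      intro x hx
      exact if_neg fun hc => hx (parent_eq hG hc).symm
  rw [tsum_congr h1, ENNReal.tsum_add, tsum_ite_eq, ENNReal.tsum_comm]
  congr 1
  refine tsum_congr fun x => ?_
  rw [tsum_eq_sum (s := children G O x) fun y hy => if_neg hy]
  exact Finset.sum_congr rfl fun y hy => if_pos hy

theorem tsum_dist_eq (h : IsSphericallyHomogeneous G O κ) (n : ℕ) :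
    ∑' x, (if G.dist O x = n then 1 else 0 : ℝ≥0∞) = ∏ j ∈ range n, (κ j : ℝ≥0∞) := by
  induction n with
  | zero =>
    classical
    simp_rw [dist_root_eq_zero_iff h.isTree]
    simp
  | succ n ih =>
    rw [tsum_eq_root_add_tsum_children h.isTree, SimpleGraph.dist_self, if_neg (by omega), zero_add,
      Finset.prod_range_succ, ← ih, ← ENNReal.tsum_mul_right]
    refine tsum_congr fun x => ?_
    rw [Finset.sum_congr rfl (g := fun _ => if G.dist O x = n then (1 : ℝ≥0∞) else 0),
      Finset.sum_const, card_children h, nsmul_eq_mul]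
    · split_ifs with hx
      · rw [hx, one_mul, mul_one]
      · simp
    · intro y hy
      rw [(mem_children.1 hy).2]
      simp

theorem finite_dist_le (h : IsSphericallyHomogeneous G O κ) (n : ℕ) :
    {x | G.dist O x ≤ n}.Finite := by
  have h1 : ∀ j, {x | G.dist O x = j}.Finite := by
    intro j
    have h2 : ∑' x, (if G.dist O x = j then 1 else 0 : ℝ≥0∞) ≠ ∞ := by
      rw [tsum_dist_eq h]
      exact ENNReal.prod_ne_top fun i _ => ENNReal.natCast_ne_top _
    refine (ENNReal.finite_const_le_of_tsum_ne_top h2 one_ne_zero).subset fun x hx => ?_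
    rw [Set.mem_ofPred_eq] at hx ⊢
    rw [if_pos hx]
  refine ((Set.finite_Iic n).biUnion fun j _ => h1 j).subset fun x hx => ?_
  exact Set.mem_biUnion (Set.mem_Iic.2 hx) rfl

/-! ### The Laplacian of a sparse tree is self-adjoint -/

/-- The edges between the levels `n` and `n + 1` form a perfect matching when `κ n = 1`, so the
commutator of the Laplacian with the cutoff at level `n` has norm at most one. -/
theorem hasGoodCutoffs_laplacian (h : IsSphericallyHomogeneous G O κ)
    (hone : ∀ N, ∃ n, N ≤ n ∧ κ n = 1) :
    HasGoodCutoffs (formalLaplacian G) (formalLaplacian_support G) (G.dist O) where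
  finite_le := finite_dist_le h
  inner_applySingle x f := by
    classical
    have h1 : applySingle (formalLaplacian G) (formalLaplacian_support G) x =
        ∑ y ∈ G.neighborFinset x, lp.single 2 y (1 : ℂ) := by
      refine lp.ext (funext fun j => ?_)
      rw [lp.coeFn_sum, Finset.sum_apply]
      change ∑ y ∈ G.neighborFinset j, (Pi.single x 1 : V → ℂ) y = _
      simp only [lp.single_apply, Pi.single_apply, Finset.sum_ite_eq, Finset.sum_ite_eq',
        SimpleGraph.mem_neighborFinset, SimpleGraph.adj_comm]
    rw [h1, sum_inner]
    change _ = ∑ y ∈ G.neighborFinset x, f y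
    refine Finset.sum_congr rfl fun y _ => ?_
    rw [lp.inner_single_left]
    simp
  exists_cutoff N := by
    classical
    have hG := h.isTree
    obtain ⟨n, hn, hκn⟩ := hone N
    refine ⟨n, hn, fun f => ?_⟩
    -- The commutator lives on the levels `n` and `n + 1`; `A` and `C` are the squares of its values.
    let A : V → ℝ≥0∞ := fun x => if G.dist O x = n then ∑ y ∈ children G O x, ‖f y‖ₑ ^ 2 else 0
    let C : V → ℝ≥0∞ := fun y => if G.dist O y = n + 1 then ‖f (parent G O y)‖ₑ ^ 2 else 0
    have hE : ∀ x, ‖(formalLaplacian G (cutoff (G.dist O) n f) -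
        cutoff (G.dist O) n (formalLaplacian G f)) x‖ₑ ^ 2 = A x + C x := by
      intro x
      have hch : ∑ y ∈ children G O x, cutoff (G.dist O) n f y =
          if G.dist O x + 1 ≤ n then ∑ y ∈ children G O x, f y else 0 := by
        split_ifs with hx
        · refine Finset.sum_congr rfl fun y hy => ?_
          rw [cutoff, (mem_children.1 hy).2, if_pos hx]
        · refine Finset.sum_eq_zero fun y hy => ?_
          rw [cutoff, (mem_children.1 hy).2, if_neg hx]
      have hpa : atParent G O (cutoff (G.dist O) n f) x =
          if G.dist O x ≤ n + 1 then atParent G O f x else 0 := by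
        by_cases hx : x = O
        · simp [atParent, hx]
        · simp [atParent, hx, cutoff, dist_parent hG hx]
      rw [Pi.sub_apply, formalLaplacian_apply hG (O := O), hch, hpa, cutoff,
        formalLaplacian_apply hG (O := O)]
      simp only [A, C]
      rcases lt_trichotomy (G.dist O x) n with hx | hx | hx
      · rw [if_pos (by omega), if_pos (by omega), if_pos (by omega), if_neg (by omega),
          if_neg (by omega)]
        simp
      · rw [if_pos (by omega), if_neg (by omega), if_pos (by omega), if_pos hx,
          if_neg (by omega)]
        have hc := card_children h x
        rw [hx, hκn, Finset.card_eq_one] at hc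
        obtain ⟨y, hy⟩ := hc
        simp [hy]
      · rcases eq_or_ne (G.dist O x) (n + 1) with hx1 | hx1
        · have hx0 : x ≠ O := by
            rintro rfl
            simp at hx
          rw [if_pos (by omega), if_neg (by omega), if_neg (by omega), if_neg (by omega),
            if_pos hx1]
          simp [atParent, hx0]
        · rw [if_neg (by omega), if_neg (by omega), if_neg (by omega), if_neg (by omega),
            if_neg (by omega)]
          simp
    have hA : ∑' x, A x = ∑' y, if G.dist O y = n + 1 then ‖f y‖ₑ ^ 2 else 0 := by
      rw [tsum_eq_root_add_tsum_children hG (fun y => if G.dist O y = n + 1 then ‖f y‖ₑ ^ 2 else 0),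
        SimpleGraph.dist_self, if_neg (by omega), zero_add]
      refine tsum_congr fun x => ?_
      simp only [A]
      split_ifs with hx
      · exact Finset.sum_congr rfl fun y hy => by rw [(mem_children.1 hy).2, hx, if_pos rfl]
      · exact (Finset.sum_eq_zero fun y hy => by
          rw [(mem_children.1 hy).2, if_neg (by omega)]).symm
    have hC : ∑' x, C x = ∑' x, if G.dist O x = n then ‖f x‖ₑ ^ 2 else 0 := by
      rw [tsum_eq_root_add_tsum_children hG C]
      simp only [C]
      rw [SimpleGraph.dist_self, if_neg (by omega), zero_add]
      refine tsum_congr fun x => ?_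
      rw [Finset.sum_congr rfl (g := fun _ => if G.dist O x = n then ‖f x‖ₑ ^ 2 else 0)]
      · rw [Finset.sum_const, card_children h]
        split_ifs with hx
        · rw [hx, hκn, one_smul]
        · simp
      · intro y hy
        rw [(mem_children.1 hy).2, parent_eq hG hy]
        simp
    rw [sqSum, tsum_congr hE, ENNReal.tsum_add, hA, hC, ← ENNReal.tsum_add]
    refine ENNReal.tsum_le_tsum fun x => ?_
    rw [tail]
    split_ifs <;> first | omega | simp

end Tree

/-! ### Decomposition of functions on the tree -/

section Decomposition

open scoped ENNReal
open Finset (range)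

/-- The variance identity `∑ |f|² = |m|² + ∑ |f - m / √n|²` for the normalized sum
`m = (∑ f) / √n` of `n` numbers. -/
theorem sum_norm_sq_eq_add_sum_sub {V : Type*} {t : Finset V} {n : ℕ} (hn : n ≠ 0)
    (ht : t.card = n) (f : V → ℂ) {m : ℂ} (hm : m = ((√(n : ℝ) : ℝ) : ℂ)⁻¹ * ∑ y ∈ t, f y) :
    ∑ y ∈ t, ‖f y‖ ^ 2 = ‖m‖ ^ 2 + ∑ y ∈ t, ‖f y - ((√(n : ℝ) : ℝ) : ℂ)⁻¹ * m‖ ^ 2 := by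
  set s : ℝ := √(n : ℝ) with hs
  have hs0 : s ≠ 0 := (Real.sqrt_pos.2 (by positivity)).ne'
  have hs2 : s ^ 2 = n := Real.sq_sqrt (Nat.cast_nonneg n)
  have hsc : (s : ℂ) ≠ 0 := Complex.ofReal_ne_zero.2 hs0
  have hsum : ∑ y ∈ t, f y = s * m := by rw [hm, mul_inv_cancel_left₀ hsc]
  have key : ∑ y ∈ t, ‖f y - (s : ℂ)⁻¹ * m‖ ^ 2 =
      ∑ y ∈ t, ‖f y‖ ^ 2 - 2 * (inner ℝ (∑ y ∈ t, f y) ((s : ℂ)⁻¹ * m)) +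
        n * ‖(s : ℂ)⁻¹ * m‖ ^ 2 := by
    simp_rw [norm_sub_sq_real]
    rw [Finset.sum_add_distrib, Finset.sum_sub_distrib, Finset.sum_const, ht, nsmul_eq_mul,
      sum_inner, Finset.mul_sum]
  have h1 : inner ℝ (∑ y ∈ t, f y) ((s : ℂ)⁻¹ * m) = ‖m‖ ^ 2 := by
    rw [hsum, ← Complex.ofReal_inv, ← Complex.real_smul, ← Complex.real_smul, real_inner_smul_left,
      real_inner_smul_right, real_inner_self_eq_norm_sq]
    field_simp
  have h2 : (n : ℝ) * ‖(s : ℂ)⁻¹ * m‖ ^ 2 = ‖m‖ ^ 2 := by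
    rw [norm_mul, norm_inv, Complex.norm_real, mul_pow, inv_pow, Real.norm_eq_abs, sq_abs, ← hs2]
    field_simp
  rw [key, h1, h2]
  ring

variable {V : Type*} (G : SimpleGraph V) [G.LocallyFinite] (O : V) (κ : ℕ → ℕ)

/-- The normalized sum over the children, `(B f)(x) = κ^{-1/2} ∑_{y child of x} f(y)`, where
`κ` is the number of children of `x`. It is the adjoint of an isometry. -/
noncomputable def childSum : (V → ℂ) →ₗ[ℂ] (V → ℂ) where
  toFun f x := ((√(κ (G.dist O x) : ℝ) : ℝ) : ℂ)⁻¹ * ∑ y ∈ children G O x, f y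
  map_add' f g := by
    ext x
    simp [Finset.sum_add_distrib, mul_add]
  map_smul' c f := by
    ext x
    simp [← Finset.mul_sum, mul_left_comm]

open Classical in
/-- The difference `(D f)(y)` of `f(y)` and the mean of `f` over `y` and its siblings; at the root
it is `f` itself. -/
noncomputable def deviation : (V → ℂ) →ₗ[ℂ] (V → ℂ) where
  toFun f y := if y = O then f y else
    f y - ((√(κ (G.dist O (parent G O y)) : ℝ) : ℝ) : ℂ)⁻¹ * childSum G O κ f (parent G O y)
  map_add' f g := by
    ext x
    simp only [map_add, Pi.add_apply]
    split_ifs <;> ring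
  map_smul' c f := by
    ext x
    simp only [map_smul, Pi.smul_apply, smul_eq_mul, RingHom.id_apply]
    split_ifs <;> ring

variable {G O κ}

theorem childSum_apply (f : V → ℂ) (x : V) : childSum G O κ f x =
    ((√(κ (G.dist O x) : ℝ) : ℝ) : ℂ)⁻¹ * ∑ y ∈ children G O x, f y := rfl

theorem deviation_root (f : V → ℂ) : deviation G O κ f O = f O := if_pos rfl

theorem deviation_of_ne (f : V → ℂ) {y : V} (hy : y ≠ O) : deviation G O κ f y =
    f y - ((√(κ (G.dist O (parent G O y)) : ℝ) : ℝ) : ℂ)⁻¹ *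
      childSum G O κ f (parent G O y) := if_neg hy

theorem sqrt_ne_zero_of_ne_zero (hκ : ∀ j, κ j ≠ 0) (j : ℕ) :
    ((√(κ j : ℝ) : ℝ) : ℂ) ≠ 0 := by
  have := Nat.pos_of_ne_zero (hκ j)
  exact Complex.ofReal_ne_zero.2 (Real.sqrt_pos.2 (by exact_mod_cast this)).ne'

theorem sqSum_eq_childSum_add_deviation (h : IsSphericallyHomogeneous G O κ) (hκ : ∀ j, κ j ≠ 0)
    (f : V → ℂ) :
    sqSum f = sqSum (childSum G O κ f) + sqSum (deviation G O κ f) := by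
  have hG := h.isTree
  have h0 : ∀ a : ℂ, ‖a‖ₑ ^ 2 = ENNReal.ofReal (‖a‖ ^ 2) := fun a => by
    rw [ENNReal.ofReal_pow (norm_nonneg _), ofReal_norm]
  have h1 : ∀ x, ∑ y ∈ children G O x, ‖f y‖ₑ ^ 2 = ‖childSum G O κ f x‖ₑ ^ 2 +
      ∑ y ∈ children G O x, ‖deviation G O κ f y‖ₑ ^ 2 := by
    intro x
    have hdev : ∀ y ∈ children G O x, deviation G O κ f y =
        f y - ((√(κ (G.dist O x) : ℝ) : ℝ) : ℂ)⁻¹ * childSum G O κ f x := fun y hy => by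
      rw [deviation_of_ne f (ne_root_of_mem_children hy), parent_eq hG hy]
    simp_rw [h0]
    rw [← ENNReal.ofReal_sum_of_nonneg fun _ _ => sq_nonneg _,
      ← ENNReal.ofReal_sum_of_nonneg fun _ _ => sq_nonneg _,
      ← ENNReal.ofReal_add (sq_nonneg _) (Finset.sum_nonneg fun _ _ => sq_nonneg _),
      sum_norm_sq_eq_add_sum_sub (hκ _) (card_children h x) f (childSum_apply f x)]
    congr 2
    exact Finset.sum_congr rfl fun y hy => by rw [hdev y hy]
  rw [sqSum, tsum_eq_root_add_tsum_children hG, tsum_congr h1, ENNReal.tsum_add, sqSum, sqSum,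
    tsum_eq_root_add_tsum_children (O := O) hG (fun y => ‖deviation G O κ f y‖ₑ ^ 2), deviation_root]
  ring

theorem sqSum_childSum_iterate_le (h : IsSphericallyHomogeneous G O κ) (hκ : ∀ j, κ j ≠ 0)
    (n : ℕ) (f : V → ℂ) : sqSum ((childSum G O κ ^ n) f) ≤ sqSum f := by
  induction n with
  | zero => rfl
  | succ n ih =>
    rw [pow_succ', Module.End.mul_apply]
    refine le_trans ?_ ih
    rw [sqSum_eq_childSum_add_deviation h hκ ((childSum G O κ ^ n) f)]
    exact le_self_add

theorem childSum_iterate_congr {f g : V → ℂ} {n m : ℕ}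
    (hfg : ∀ x, m + n ≤ G.dist O x → f x = g x) :
    ∀ x, m ≤ G.dist O x → (childSum G O κ ^ n) f x = (childSum G O κ ^ n) g x := by
  induction n generalizing m with
  | zero => exact hfg
  | succ n ih =>
    intro x hx
    rw [pow_succ', Module.End.mul_apply, Module.End.mul_apply, childSum_apply, childSum_apply]
    congr 1
    refine Finset.sum_congr rfl fun y hy => ?_
    refine ih (m := m + 1) (fun x hx => hfg x (by omega)) y ?_
    rw [(mem_children.1 hy).2]
    omega

/-- `f` is recovered, as far as its norm is concerned, from the deviations `D Bⁱ f`. -/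
theorem sqSum_eq_tsum_deviation (h : IsSphericallyHomogeneous G O κ) (hκ : ∀ j, κ j ≠ 0)
    {f : V → ℂ} (hf : sqSum f ≠ ∞) :
    sqSum f = ∑' i, sqSum (deviation G O κ ((childSum G O κ ^ i) f)) := by
  have h1 : ∀ n, sqSum f = ∑ i ∈ range n, sqSum (deviation G O κ ((childSum G O κ ^ i) f)) +
      sqSum ((childSum G O κ ^ n) f) := by
    intro n
    induction n with
    | zero => simp
    | succ n ih =>
      rw [Finset.sum_range_succ, ih, sqSum_eq_childSum_add_deviation h hκ ((childSum G O κ ^ n) f),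
        pow_succ', Module.End.mul_apply]
      ring
  have h2 : Tendsto (fun n => sqSum ((childSum G O κ ^ n) f)) atTop (𝓝 0) := by
    refine tendsto_of_tendsto_of_tendsto_of_le_of_le tendsto_const_nhds
      (tendsto_sqSum_tail (G.dist O) hf) (fun _ => zero_le) fun n => ?_
    have h3 : (childSum G O κ ^ n) f = (childSum G O κ ^ n) (tail (G.dist O) n f) := by
      funext x
      refine childSum_iterate_congr (m := 0) (fun y hy => ?_) x (Nat.zero_le _)
      rw [tail, if_pos (by omega)]
    change sqSum ((childSum G O κ ^ n) f) ≤ _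
    rw [h3]
    exact sqSum_childSum_iterate_le h hκ n _
  have h4 := (ENNReal.tendsto_nat_tsum
    (fun i => sqSum (deviation G O κ ((childSum G O κ ^ i) f)))).add h2
  rw [add_zero] at h4
  exact tendsto_nhds_unique (tendsto_const_nhds.congr h1) h4

variable (G O κ) in
/-- The component of `f` at the vertex `y`: the sequence that vanishes below the level `|y|` of `y`
and whose value at level `|y| + i` is `(D Bⁱ f)(y)`. -/
noncomputable def component (y : V) : (V → ℂ) →ₗ[ℂ] (ℕ → ℂ) where
  toFun f m := if G.dist O y ≤ m then
    deviation G O κ ((childSum G O κ ^ (m - G.dist O y)) f) y else 0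
  map_add' f g := by
    ext m
    simp only [map_add, Pi.add_apply]
    split_ifs <;> simp
  map_smul' c f := by
    ext m
    simp only [map_smul, Pi.smul_apply, RingHom.id_apply]
    split_ifs <;> simp

theorem component_add (f : V → ℂ) (y : V) (i : ℕ) : component G O κ y f (G.dist O y + i) =
    deviation G O κ ((childSum G O κ ^ i) f) y := by
  change (if _ then _ else _) = _
  rw [if_pos (Nat.le_add_right _ _), Nat.add_sub_cancel_left]

theorem component_of_lt (f : V → ℂ) (y : V) {m : ℕ} (hm : m < G.dist O y) :
    component G O κ y f m = 0 := if_neg (by omega)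

theorem sqSum_component (f : V → ℂ) (y : V) : sqSum (component G O κ y f) =
    ∑' i, ‖deviation G O κ ((childSum G O κ ^ i) f) y‖ₑ ^ 2 := by
  have hinj : Function.Injective fun i : ℕ => G.dist O y + i := add_right_injective _
  rw [sqSum, ← hinj.tsum_eq]
  · exact tsum_congr fun i => by rw [component_add]
  · intro m hm
    refine ⟨m - G.dist O y, Nat.add_sub_cancel' ?_⟩
    by_contra hlt
    exact hm (by simp [component_of_lt f y (not_le.1 hlt)])

/-- The map from `f` to the family of its components is isometric. -/
theorem tsum_sqSum_component (h : IsSphericallyHomogeneous G O κ) (hκ : ∀ j, κ j ≠ 0)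
    {f : V → ℂ} (hf : sqSum f ≠ ∞) : ∑' y, sqSum (component G O κ y f) = sqSum f := by
  simp_rw [sqSum_component]
  rw [ENNReal.tsum_comm, sqSum_eq_tsum_deviation h hκ hf]
  rfl

theorem component_eq_zero (h : IsSphericallyHomogeneous G O κ) {y p : V}
    (hp : y ∈ children G O p) (hκp : κ (G.dist O p) = 1) (f : V → ℂ) :
    component G O κ y f = 0 := by
  have hc := card_children h p
  rw [hκp, Finset.card_eq_one] at hc
  obtain ⟨y', hy'⟩ := hc
  have hyy : y = y' := by rwa [hy', Finset.mem_singleton] at hp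
  have hd : ∀ g, deviation G O κ g y = 0 := by
    intro g
    rw [deviation_of_ne g (ne_root_of_mem_children hp), parent_eq h.isTree hp, childSum_apply, hκp,
      hy', ← hyy]
    simp
  funext m
  change (if _ then _ else _) = _
  rw [hd]
  simp

/-! ### The action of the Laplacian on the components -/

theorem childSum_iterate_laplacian (h : IsSphericallyHomogeneous G O κ) (hκ : ∀ j, κ j ≠ 0)
    (f : V → ℂ) (i : ℕ) (x : V) :
    (childSum G O κ ^ (i + 1)) (formalLaplacian G f) x =
      ((√(κ (G.dist O x + i) : ℝ) : ℝ) : ℂ) * (childSum G O κ ^ i) f x +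
      ((√(κ (G.dist O x + i + 1) : ℝ) : ℝ) : ℂ) * (childSum G O κ ^ (i + 2)) f x := by
  have hG := h.isTree
  induction i generalizing x with
  | zero =>
    have h1 : ∀ y ∈ children G O x, formalLaplacian G f y =
        f x + ((√(κ (G.dist O x + 1) : ℝ) : ℝ) : ℂ) * childSum G O κ f y := by
      intro y hy
      rw [formalLaplacian_apply (O := O) hG, atParent, if_neg (ne_root_of_mem_children hy),
        parent_eq hG hy, childSum_apply, (mem_children.1 hy).2,
        mul_inv_cancel_left₀ (sqrt_ne_zero_of_ne_zero hκ _)]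
    rw [zero_add, pow_one, pow_zero, Module.End.one_apply, childSum_apply, Finset.sum_congr rfl h1,
      Finset.sum_add_distrib, Finset.sum_const, card_children h, ← Finset.mul_sum, zero_add,
      pow_two, Module.End.mul_apply, childSum_apply (childSum G O κ f), add_zero]
    have h2 : ((κ (G.dist O x) : ℕ) : ℂ) =
        ((√(κ (G.dist O x) : ℝ) : ℝ) : ℂ) * ((√(κ (G.dist O x) : ℝ) : ℝ) : ℂ) := by
      rw [← Complex.ofReal_mul, Real.mul_self_sqrt (Nat.cast_nonneg _), Complex.ofReal_natCast]
    have h3 := sqrt_ne_zero_of_ne_zero hκ (G.dist O x)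
    rw [nsmul_eq_mul, h2]
    field_simp
  | succ i ih =>
    rw [pow_succ', Module.End.mul_apply, childSum_apply]
    have h1 : ∀ y ∈ children G O x, (childSum G O κ ^ (i + 1)) (formalLaplacian G f) y =
        ((√(κ (G.dist O x + (i + 1)) : ℝ) : ℝ) : ℂ) * (childSum G O κ ^ i) f y +
        ((√(κ (G.dist O x + (i + 1) + 1) : ℝ) : ℝ) : ℂ) * (childSum G O κ ^ (i + 2)) f y := by
      intro y hy
      rw [ih, (mem_children.1 hy).2, add_assoc (G.dist O x) 1 i, add_comm 1 i]
    rw [Finset.sum_congr rfl h1, Finset.sum_add_distrib, ← Finset.mul_sum, ← Finset.mul_sum,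
      pow_succ' _ i, pow_succ' _ (i + 2), Module.End.mul_apply, Module.End.mul_apply,
      childSum_apply, childSum_apply]
    ring

theorem deviation_laplacian (h : IsSphericallyHomogeneous G O κ) (hκ : ∀ j, κ j ≠ 0)
    (f : V → ℂ) (y : V) :
    deviation G O κ (formalLaplacian G f) y =
      ((√(κ (G.dist O y) : ℝ) : ℝ) : ℂ) * deviation G O κ (childSum G O κ f) y := by
  have hG := h.isTree
  have h1 := formalLaplacian_apply (O := O) hG f y
  have h2 : ∑ x ∈ children G O y, f x =
      ((√(κ (G.dist O y) : ℝ) : ℝ) : ℂ) * childSum G O κ f y := by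
    rw [childSum_apply, mul_inv_cancel_left₀ (sqrt_ne_zero_of_ne_zero hκ _)]
  rw [h2] at h1
  by_cases hy : y = O
  · subst hy
    rw [deviation_root, deviation_root, h1, atParent, if_pos rfl, zero_add]
  · rw [deviation_of_ne _ hy, deviation_of_ne _ hy, h1, atParent, if_neg hy]
    have h3 := childSum_iterate_laplacian h hκ f 0 (parent G O y)
    rw [zero_add, pow_one, pow_zero, Module.End.one_apply, add_zero, zero_add, pow_two,
      Module.End.mul_apply, ← dist_parent hG hy] at h3
    have h4 := sqrt_ne_zero_of_ne_zero hκ (G.dist O (parent G O y))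
    rw [h3]
    field_simp
    ring

theorem deviation_iterate_laplacian (h : IsSphericallyHomogeneous G O κ) (hκ : ∀ j, κ j ≠ 0)
    (f : V → ℂ) (i : ℕ) (y : V) :
    deviation G O κ ((childSum G O κ ^ (i + 1)) (formalLaplacian G f)) y =
      ((√(κ (G.dist O y + i) : ℝ) : ℝ) : ℂ) * deviation G O κ ((childSum G O κ ^ i) f) y +
      ((√(κ (G.dist O y + i + 1) : ℝ) : ℝ) : ℂ) *
        deviation G O κ ((childSum G O κ ^ (i + 2)) f) y := by
  have hG := h.isTree
  by_cases hy : y = O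
  · subst hy
    simp only [deviation_root]
    exact childSum_iterate_laplacian h hκ f i y
  · have hB : ∀ (n : ℕ) (g : V → ℂ), childSum G O κ ((childSum G O κ ^ n) g) =
        (childSum G O κ ^ (n + 1)) g := fun n g => by rw [pow_succ', Module.End.mul_apply]
    simp only [deviation_of_ne _ hy, hB]
    rw [childSum_iterate_laplacian h hκ f i y,
      childSum_iterate_laplacian h hκ f (i + 1) (parent G O y), dist_parent hG hy]
    rw [show G.dist O (parent G O y) + 1 + i = G.dist O (parent G O y) + (i + 1) by omega]
    ring

/-- The components intertwine the Laplacian with the Jacobi matrix with entries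
`a (j + 1) = √(κ j)`, on the levels from that of `y` on. -/
theorem component_laplacian (h : IsSphericallyHomogeneous G O κ) (hκ : ∀ j, κ j ≠ 0)
    {a : ℕ → ℝ} (ha : ∀ j, a (j + 1) = √(κ j : ℝ)) (f : V → ℂ) (y : V) {m : ℕ}
    (hm : G.dist O y ≤ m) :
    component G O κ y (formalLaplacian G f) m =
      formalJacobi a (fun _ => 0) (component G O κ y f) m := by
  obtain ⟨i, rfl⟩ := Nat.exists_eq_add_of_le hm
  have hJ : ∀ (u : ℕ → ℂ) (n : ℕ), formalJacobi a (fun _ => 0) u (n + 1) =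
      ((√(κ n : ℝ) : ℝ) : ℂ) * u n + ((√(κ (n + 1) : ℝ) : ℝ) : ℂ) * u (n + 2) := by
    intro u n
    rw [← ha, ← ha]
    simp [formalJacobi]
  have hJ0 : ∀ u : ℕ → ℂ, formalJacobi a (fun _ => 0) u 0 = ((√(κ 0 : ℝ) : ℝ) : ℂ) * u 1 := by
    intro u
    rw [← ha]
    simp [formalJacobi]
  rw [component_add]
  cases i with
  | zero =>
    rw [add_zero, pow_zero, Module.End.one_apply, deviation_laplacian h hκ]
    have h1 : component G O κ y f (G.dist O y + 1) = deviation G O κ (childSum G O κ f) y := by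
      rw [component_add, pow_one]
    rcases hd : G.dist O y with _ | n
    · rw [hd] at h1
      rw [hJ0, ← h1]
    · rw [hJ, component_of_lt f y (by omega), mul_zero, zero_add, ← h1, hd]
  | succ i =>
    rw [deviation_iterate_laplacian h hκ, ← component_add, ← component_add,
      ← add_assoc (G.dist O y) i 1, hJ]
    rfl

/-! ### Radial functions -/

variable (G O κ) in
/-- The radial function on the tree with value `u j / √(κ 0 ⋯ κ (j - 1))` on level `j`; the
product under the root is the number of vertices on that level. -/
noncomputable def radial : (ℕ → ℂ) →ₗ[ℂ] (V → ℂ) where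
  toFun u x := (∏ j ∈ range (G.dist O x), ((√(κ j : ℝ) : ℝ) : ℂ))⁻¹ * u (G.dist O x)
  map_add' u v := by
    ext x
    simp [mul_add]
  map_smul' c u := by
    ext x
    simp [mul_left_comm]

theorem radial_apply {V : Type*} {G : SimpleGraph V} {O : V} {κ : ℕ → ℕ} (u : ℕ → ℂ) (x : V) :
    radial G O κ u x = (∏ j ∈ range (G.dist O x), ((√(κ j : ℝ) : ℝ) : ℂ))⁻¹ * u (G.dist O x) := rfl

theorem sqSum_radial (h : IsSphericallyHomogeneous G O κ) (hκ : ∀ j, κ j ≠ 0) (u : ℕ → ℂ) :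
    sqSum (radial G O κ u) = sqSum u := by
  have h1 : ∀ x, ‖radial G O κ u x‖ₑ ^ 2 = ∑' n, (if G.dist O x = n then 1 else 0) *
      ((∏ j ∈ range n, (κ j : ℝ≥0∞))⁻¹ * ‖u n‖ₑ ^ 2) := by
    intro x
    rw [tsum_eq_single (G.dist O x) (fun n hn => by rw [if_neg (Ne.symm hn), zero_mul]), if_pos rfl,
      one_mul, radial_apply, enorm_mul, mul_pow]
    congr 1
    have hP : (∏ j ∈ range (G.dist O x), ((√(κ j : ℝ) : ℝ) : ℂ)) ≠ 0 :=
      Finset.prod_ne_zero_iff.2 fun j _ => sqrt_ne_zero_of_ne_zero hκ j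
    rw [enorm_inv hP, ← ENNReal.inv_pow]
    congr 1
    rw [← ofReal_norm, ← ENNReal.ofReal_pow (norm_nonneg _), norm_prod, ← Finset.prod_pow,
      ENNReal.ofReal_prod_of_nonneg fun _ _ => sq_nonneg _]
    refine Finset.prod_congr rfl fun j _ => ?_
    rw [Complex.norm_real, Real.norm_eq_abs, sq_abs, Real.sq_sqrt (Nat.cast_nonneg _),
      ENNReal.ofReal_natCast]
  rw [sqSum, tsum_congr h1, ENNReal.tsum_comm, sqSum]
  refine tsum_congr fun n => ?_
  rw [ENNReal.tsum_mul_right, tsum_dist_eq h, ← mul_assoc, ENNReal.mul_inv_cancel, one_mul]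
  · exact Finset.prod_ne_zero_iff.2 fun j _ => Nat.cast_ne_zero.2 (hκ j)
  · exact ENNReal.prod_ne_top fun i _ => ENNReal.natCast_ne_top _

theorem laplacian_radial (h : IsSphericallyHomogeneous G O κ) (hκ : ∀ j, κ j ≠ 0)
    {a : ℕ → ℝ} (ha : ∀ j, a (j + 1) = √(κ j : ℝ)) (u : ℕ → ℂ) :
    formalLaplacian G (radial G O κ u) = radial G O κ (formalJacobi a (fun _ => 0) u) := by
  have hG := h.isTree
  funext x
  have h1 : ∑ y ∈ children G O x, radial G O κ u y =
      (∏ j ∈ range (G.dist O x), ((√(κ j : ℝ) : ℝ) : ℂ))⁻¹ *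
        (((√(κ (G.dist O x) : ℝ) : ℝ) : ℂ) * u (G.dist O x + 1)) := by
    rw [Finset.sum_congr rfl (g := fun _ =>
      (∏ j ∈ range (G.dist O x + 1), ((√(κ j : ℝ) : ℝ) : ℂ))⁻¹ * u (G.dist O x + 1))
      (fun y hy => by rw [radial_apply, (mem_children.1 hy).2]), Finset.sum_const, card_children h,
      Finset.prod_range_succ, nsmul_eq_mul, mul_inv]
    have h2 : ((κ (G.dist O x) : ℕ) : ℂ) =
        ((√(κ (G.dist O x) : ℝ) : ℝ) : ℂ) * ((√(κ (G.dist O x) : ℝ) : ℝ) : ℂ) := by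
      rw [← Complex.ofReal_mul, Real.mul_self_sqrt (Nat.cast_nonneg _), Complex.ofReal_natCast]
    have h3 := sqrt_ne_zero_of_ne_zero hκ (G.dist O x)
    rw [h2]
    field_simp
  rw [formalLaplacian_apply (O := O) hG, h1, radial_apply, atParent]
  split_ifs with hx
  · subst hx
    rw [SimpleGraph.dist_self, ← ha]
    simp [formalJacobi]
  · rw [radial_apply, dist_parent hG hx, Finset.prod_range_succ, mul_inv, ← ha, ← ha]
    have h3 := sqrt_ne_zero_of_ne_zero hκ (G.dist O (parent G O x))
    rw [← ha] at h3
    simp only [formalJacobi, LinearMap.coe_mk, AddHom.coe_mk]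
    field_simp
    simp

end Decomposition

/-! ### Jacobi matrices with zero diagonal -/

section Jacobi

open scoped ENNReal
open Finset (range)

theorem formalJacobi_apply (a : ℕ → ℝ) (u : ℕ → ℂ) (m : ℕ) :
    formalJacobi a (fun _ => 0) u m =
      (if m = 0 then 0 else (a m : ℂ) * u (m - 1)) + (a (m + 1) : ℂ) * u (m + 1) := by
  cases m <;> simp [formalJacobi]

/-- The commutator of the Jacobi matrix with the cutoff at site `n` has norm `|a (n + 1)|`. -/
theorem hasGoodCutoffs_jacobi {a : ℕ → ℝ} (hone : ∀ N, ∃ n, N ≤ n ∧ a (n + 1) = 1) :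
    HasGoodCutoffs (formalJacobi a (fun _ => 0)) (formalJacobi_support a (fun _ => 0))
      (fun n : ℕ => n) where
  finite_le n := Set.finite_Iic n
  inner_applySingle x f := by
    have h1 : applySingle (formalJacobi a (fun _ => 0)) (formalJacobi_support a (fun _ => 0)) x =
        (if x = 0 then 0 else (a x : ℂ) • lp.single 2 (x - 1) (1 : ℂ)) +
          (a (x + 1) : ℂ) • lp.single 2 (x + 1) (1 : ℂ) := by
      refine lp.ext (funext fun j => ?_)
      have h0 : applySingle (formalJacobi a (fun _ => 0)) (formalJacobi_support a (fun _ => 0)) x j =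
          formalJacobi a (fun _ => 0) (Pi.single x 1) j := by
        refine congrFun (congrArg (formalJacobi a (fun _ => 0)) (funext fun i => ?_)) j
        simp only [Pi.single_apply]
        split_ifs <;> rfl
      rw [h0, formalJacobi_apply, lp.coeFn_add, Pi.add_apply, lp.coeFn_smul, Pi.smul_apply,
        lp.single_apply]
      have h2 : ((if x = 0 then 0 else (a x : ℂ) • lp.single 2 (x - 1) (1 : ℂ) : EllTwo ℕ) :
          ℕ → ℂ) j = if j + 1 = x then (a x : ℂ) else 0 := by
        split_ifs with h3 h4 h4
        · omega
        · simp
        · have : j = x - 1 := by omega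
          subst this
          rw [lp.coeFn_smul, Pi.smul_apply, lp.single_apply, Pi.single_eq_same]
          simp
        · rw [lp.coeFn_smul, Pi.smul_apply, lp.single_apply, Pi.single_eq_of_ne (by omega)]
          simp
      rw [h2, add_comm]
      congr 1
      · rw [Pi.single_apply]
        split_ifs with h3
        · rw [h3, mul_one]
        · rw [mul_zero]
      · rw [Pi.single_apply, Pi.single_apply, smul_eq_mul]
        split_ifs with h3 h4 h5 h5
        · omega
        · simp
        · rw [h5]
        · omega
        · omega
        · simp
    rw [h1, inner_add_left, inner_smul_left, lp.inner_single_left, formalJacobi_apply]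
    congr 1
    · split_ifs with hx
      · rw [inner_zero_left]
      · rw [inner_smul_left, lp.inner_single_left]
        simp
    · simp
  exists_cutoff N := by
    obtain ⟨n, hn, han⟩ := hone N
    refine ⟨n, hn, fun f => ?_⟩
    have hE : ∀ m, ‖(formalJacobi a (fun _ => 0) (cutoff (fun n : ℕ => n) n f) -
        cutoff (fun n : ℕ => n) n (formalJacobi a (fun _ => 0) f)) m‖ₑ ^ 2 =
        (if m = n then ‖f (n + 1)‖ₑ ^ 2 else 0) + (if m = n + 1 then ‖f n‖ₑ ^ 2 else 0) := by
      intro m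
      rw [Pi.sub_apply, formalJacobi_apply, cutoff, cutoff, cutoff, formalJacobi_apply]
      rcases lt_trichotomy m n with hm | hm | hm
      · rw [if_pos (by omega : m - 1 ≤ n), if_pos (by omega : m + 1 ≤ n), if_pos hm.le,
          if_neg (by omega : m ≠ n), if_neg (by omega : m ≠ n + 1), sub_self]
        simp
      · subst hm
        rw [if_pos (by omega : m - 1 ≤ m), if_neg (by omega : ¬ m + 1 ≤ m), if_pos le_rfl,
          if_pos rfl, if_neg (by omega : m ≠ m + 1), han]
        simp
      · rcases eq_or_ne m (n + 1) with hm1 | hm1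
        · subst hm1
          simp [han]
        · rw [if_neg (by omega : ¬ m - 1 ≤ n), if_neg (by omega : ¬ m + 1 ≤ n),
            if_neg (by omega : ¬ m ≤ n), if_neg (by omega : m ≠ n), if_neg hm1]
          simp
    rw [sqSum, tsum_congr hE, ENNReal.tsum_add, tsum_ite_eq, tsum_ite_eq]
    have h2 := ENNReal.sum_le_tsum (f := fun m => ‖tail (fun n : ℕ => n) n f m‖ₑ ^ 2) {n, n + 1}
    rw [Finset.sum_pair (by omega)] at h2
    simp only [tail, le_refl, if_true, Nat.le_succ] at h2
    rw [add_comm]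
    exact h2

/-! ### Sequences supported far out -/

theorem exists_inner_le_of_tail (b : EllTwo ℕ) {ε : ℝ} (hε : 0 < ε) :
    ∃ n₀, ∀ n, n₀ ≤ n → ∀ u : EllTwo ℕ, (∀ m < n, u m = 0) → ‖(inner ℂ b u : ℂ)‖ ≤ ε * ‖u‖ := by
  have h1 := tendsto_sqSum_tail (fun n : ℕ => n) (sqSum_coe_ne_top b)
  have hpos : (0 : ℝ≥0∞) < ENNReal.ofReal (ε ^ 2) := by
    rw [ENNReal.ofReal_pos]; positivity
  obtain ⟨n₀, hn₀⟩ := eventually_atTop.1 (h1.eventually_lt_const hpos)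
  refine ⟨n₀, fun n hn u hu => ?_⟩
  let t : EllTwo ℕ := ⟨tail (fun n : ℕ => n) n b, memℓp_two_iff_sqSum.2 (hn₀ n hn).ne_top⟩
  have ht : ‖t‖ < ε := norm_lt_of_sqSum_lt hε (hn₀ n hn)
  have hin : (inner ℂ b u : ℂ) = inner ℂ t u := by
    rw [lp.inner_eq_tsum, lp.inner_eq_tsum]
    refine tsum_congr fun m => ?_
    by_cases hm : n ≤ m
    · have : t m = b m := if_pos hm
      rw [this]
    · rw [hu m (not_le.1 hm), inner_zero_right, inner_zero_right]
  rw [hin]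
  exact (norm_inner_le_norm t u).trans (by gcongr)

/-- A finite-dimensional space of square-summable sequences is almost orthogonal to the sequences
supported far out. -/
theorem exists_inner_le_of_finiteDimensional (N : Submodule ℂ (EllTwo ℕ))
    [FiniteDimensional ℂ N] {ε : ℝ} (hε : 0 < ε) :
    ∃ n₀, ∀ v ∈ N, ∀ u : EllTwo ℕ, (∀ m < n₀, u m = 0) →
      ‖(inner ℂ v u : ℂ)‖ ≤ ε * (‖v‖ * ‖u‖) := by
  let b := stdOrthonormalBasis ℂ N
  set d := Module.finrank ℂ N with hd
  have hd0 : 0 < ε / (d + 1) := by positivity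
  choose n hn using fun i => exists_inner_le_of_tail (b i : EllTwo ℕ) hd0
  refine ⟨Finset.univ.sup n, fun v hv u hu => ?_⟩
  have hrepr : v = ∑ i, (inner ℂ (b i) (⟨v, hv⟩ : N) : ℂ) • (b i : EllTwo ℕ) := by
    have := congrArg Subtype.val (b.sum_repr' ⟨v, hv⟩)
    rw [Submodule.coe_sum] at this
    exact this.symm
  have hb : ∀ i, ‖(inner ℂ (b i) (⟨v, hv⟩ : N) : ℂ)‖ ≤ ‖v‖ := fun i => by
    have := norm_inner_le_norm (𝕜 := ℂ) (b i) (⟨v, hv⟩ : N)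
    rw [b.orthonormal.1 i, one_mul] at this
    exact this
  calc ‖(inner ℂ v u : ℂ)‖
      = ‖∑ i, (starRingEnd ℂ (inner ℂ (b i) (⟨v, hv⟩ : N))) * inner ℂ (b i : EllTwo ℕ) u‖ := by
        conv_lhs => rw [hrepr]
        rw [sum_inner]
        simp_rw [inner_smul_left]
    _ ≤ ∑ _i : Fin d, ‖v‖ * (ε / (d + 1) * ‖u‖) := by
        refine (norm_sum_le _ _).trans (Finset.sum_le_sum fun i _ => ?_)
        rw [norm_mul, RCLike.norm_conj]
        gcongr
        · exact hb i
        · exact hn i _ (Finset.le_sup (Finset.mem_univ i)) u hu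
    _ = (d / (d + 1)) * (ε * (‖v‖ * ‖u‖)) := by
        rw [Finset.sum_const, Finset.card_univ, Fintype.card_fin, nsmul_eq_mul]
        field_simp
    _ ≤ ε * (‖v‖ * ‖u‖) := by
        refine mul_le_of_le_one_left (by positivity) ?_
        rw [div_le_one (by positivity)]
        linarith

/-- If `u` is at distance at most `C ‖(J - z) u‖` from a finite-dimensional space for all `u`, then
`J - z` is bounded below on the sequences supported far out. -/
theorem exists_bound_of_tail {a : ℕ → ℝ} {z : ℂ} (N : Submodule ℂ (EllTwo ℕ))
    [FiniteDimensional ℂ N] {C : ℝ}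
    (hN : ∀ u w : EllTwo ℕ, formalJacobi a (fun _ => 0) u = (w : ℕ → ℂ) →
      ∃ v ∈ N, ‖u - v‖ ≤ C * ‖w - z • u‖) :
    ∃ n₀, ∀ u w : EllTwo ℕ, formalJacobi a (fun _ => 0) u = (w : ℕ → ℂ) →
      (∀ m < n₀, u m = 0) → ‖u‖ ≤ 2 * C * ‖w - z • u‖ := by
  obtain ⟨n₀, hn₀⟩ := exists_inner_le_of_finiteDimensional N (ε := 1 / 2) (by norm_num)
  refine ⟨n₀, fun u w huw hu => ?_⟩
  obtain ⟨v, hv, hle⟩ := hN u w huw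
  have h1 := hn₀ v hv u hu
  have h2 := norm_sub_sq (𝕜 := ℂ) v u
  have h3 : RCLike.re (inner ℂ v u : ℂ) ≤ 1 / 2 * (‖v‖ * ‖u‖) := (RCLike.re_le_norm _).trans h1
  rw [norm_sub_rev] at hle
  -- The almost orthogonality gives `‖v - u‖² ≥ ‖v‖² + ‖u‖² - ‖v‖ ‖u‖ ≥ (3 / 4) ‖u‖²`.
  have h4 : ‖u‖ ^ 2 ≤ (2 * ‖v - u‖) ^ 2 := by nlinarith [sq_nonneg (‖v‖ - ‖u‖ / 2)]
  have h5 := le_of_sq_le_sq h4 (by positivity)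
  linarith

/-! ### The free equation -/

/-- The solution of the free equation `U (j + 2) = x U (j + 1) - U j` with `U 0 = 1`, `U 1 = x`:
the Chebyshev polynomial of the second kind at `x / 2`. -/
def freeSolution (x : ℝ) : ℕ → ℝ
  | 0 => 1
  | 1 => x
  | j + 2 => x * freeSolution x (j + 1) - freeSolution x j

/-- The quadratic form conserved by the free equation. -/
theorem freeSolution_invariant (x : ℝ) (j : ℕ) :
    freeSolution x (j + 1) ^ 2 + freeSolution x j ^ 2 -
      x * freeSolution x j * freeSolution x (j + 1) = 1 := by
  induction j with
  | zero => simp only [freeSolution]; ring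
  | succ j ih => rw [freeSolution, ← ih]; ring

theorem one_le_mul_freeSolution_sq (x : ℝ) (j : ℕ) :
    1 ≤ (1 + |x|) * (freeSolution x j ^ 2 + freeSolution x (j + 1) ^ 2) := by
  have h1 := freeSolution_invariant x j
  set p := freeSolution x j
  set q := freeSolution x (j + 1)
  have h2 : -(x * (p * q)) ≤ |x| * (|p| * |q|) := by
    rw [← abs_mul, ← abs_mul]; exact neg_le_abs _
  have h3 : |x| * (|p| * |q|) ≤ |x| * (p ^ 2 + q ^ 2) := by
    refine mul_le_mul_of_nonneg_left ?_ (abs_nonneg x)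
    nlinarith [sq_nonneg (|p| - |q|), sq_abs p, sq_abs q, sq_nonneg p, sq_nonneg q]
  nlinarith

/-- The free solution is not square summable. -/
theorem le_sum_freeSolution_sq (x : ℝ) (n : ℕ) :
    n ≤ (1 + |x|) * ∑ j ∈ range (2 * n), freeSolution x j ^ 2 := by
  induction n with
  | zero => simp
  | succ n ih =>
    rw [Nat.mul_succ, Finset.sum_range_succ, Finset.sum_range_succ]
    have := one_le_mul_freeSolution_sq x (2 * n)
    push_cast
    linarith

/-- A perturbed solution of the free equation stays close to the free solution with the same
initial value. -/
theorem exists_norm_sub_freeSolution_le (x : ℝ) (j : ℕ) : ∃ B : ℝ, 0 ≤ B ∧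
    ∀ (p g : ℕ → ℂ) (γ : ℝ), (∀ i, ‖g i‖ ≤ γ) → (0 < j → p 1 = x * p 0 + g 0) →
      (∀ i, i + 2 ≤ j → p (i + 2) = x * p (i + 1) - p i + g (i + 1)) →
      ‖p j - freeSolution x j * p 0‖ ≤ B * γ := by
  induction j using Nat.twoStepInduction with
  | zero => exact ⟨0, le_rfl, fun p g γ _ _ _ => by simp [freeSolution]⟩
  | one =>
    refine ⟨1, zero_le_one, fun p g γ hg h0 _ => ?_⟩
    rw [h0 one_pos, freeSolution, add_sub_cancel_left, one_mul]
    exact hg 0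
  | more j ih0 ih1 =>
    obtain ⟨B0, hB0, h0⟩ := ih0
    obtain ⟨B1, hB1, h1⟩ := ih1
    refine ⟨|x| * B1 + B0 + 1, by positivity, fun p g γ hg hp0 hp => ?_⟩
    have e0 := h0 p g γ hg (fun _ => hp0 (by omega)) (fun i hi => hp i (by omega))
    have e1 := h1 p g γ hg (fun _ => hp0 (by omega)) (fun i hi => hp i (by omega))
    rw [hp j le_rfl, freeSolution]
    have : (x : ℂ) * p (j + 1) - p j + g (j + 1) -
        ((x * freeSolution x (j + 1) - freeSolution x j : ℝ) : ℂ) * p 0 =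
        x * (p (j + 1) - freeSolution x (j + 1) * p 0) - (p j - freeSolution x j * p 0) +
          g (j + 1) := by
      push_cast; ring
    rw [this]
    refine (norm_add_le _ _).trans ?_
    refine (add_le_add ((norm_sub_le _ _).trans (add_le_add_left (norm_mul_le _ _) _))
      (hg (j + 1))).trans ?_
    rw [Complex.norm_real, Real.norm_eq_abs]
    nlinarith [mul_le_mul_of_nonneg_left e1 (abs_nonneg x)]

theorem sum_range_norm_sq_le (u : EllTwo ℕ) (R n : ℕ) :
    ∑ j ∈ range n, ‖u (R + j)‖ ^ 2 ≤ ‖u‖ ^ 2 := by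
  have h1 := lp.sum_rpow_le_norm_rpow (p := 2) (by simp) u
    ((range n).map (addLeftEmbedding R))
  simpa using h1

/-- On a long free stretch starting with a Dirichlet condition, the initial value is small compared
with the norm, since the free solution is not square summable. -/
theorem exists_norm_sq_apply_le (x : ℝ) {η : ℝ} (hη : 0 < η) : ∃ ℓ : ℕ, ∃ K : ℝ, 0 ≤ K ∧
    ∀ (R : ℕ) (u g : EllTwo ℕ), u (R + 1) = x * u R + g R →
      (∀ i < ℓ, u (R + (i + 2)) = x * u (R + (i + 1)) - u (R + i) + g (R + (i + 1))) →
      ‖u R‖ ^ 2 ≤ η * ‖u‖ ^ 2 + K * ‖g‖ ^ 2 := by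
  obtain ⟨n, hn⟩ := exists_nat_gt (2 * (1 + |x|) / η)
  have hx : 0 < 1 + |x| := by positivity
  have hn0 : (0 : ℝ) < n := lt_of_le_of_lt (by positivity) hn
  choose B hB0 hB using exists_norm_sub_freeSolution_le x
  refine ⟨2 * n, (1 + |x|) / n * ∑ j ∈ range (2 * n), 2 * B j ^ 2, by positivity,
    fun R u g h0 h1 => ?_⟩
  have hj : ∀ j ∈ range (2 * n), freeSolution x j ^ 2 * ‖u R‖ ^ 2 ≤
      2 * ‖u (R + j)‖ ^ 2 + 2 * B j ^ 2 * ‖g‖ ^ 2 := by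
    intro j hj
    rw [Finset.mem_range] at hj
    have h2 := hB j (fun i => u (R + i)) (fun i => g (R + i)) ‖g‖
      (fun i => lp.norm_apply_le_norm (by simp) g _) (fun _ => h0)
      (fun i hi => h1 i (by omega))
    simp only [add_zero] at h2
    have h3 : ‖(freeSolution x j : ℂ) * u R‖ ≤ ‖u (R + j)‖ + B j * ‖g‖ := by
      refine (norm_le_norm_add_norm_sub (u (R + j)) _).trans ?_
      linarith
    rw [norm_mul, Complex.norm_real, Real.norm_eq_abs] at h3
    have h4 : (|freeSolution x j| * ‖u R‖) ^ 2 ≤ (‖u (R + j)‖ + B j * ‖g‖) ^ 2 := by gcongr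
    rw [mul_pow, sq_abs] at h4
    nlinarith [sq_nonneg (‖u (R + j)‖ - B j * ‖g‖)]
  have hsum := Finset.sum_le_sum hj
  rw [← Finset.sum_mul, Finset.sum_add_distrib, ← Finset.mul_sum, ← Finset.sum_mul] at hsum
  have h5 := le_sum_freeSolution_sq x n
  have h6 := sum_range_norm_sq_le u R (2 * n)
  set S := ∑ j ∈ range (2 * n), freeSolution x j ^ 2
  set T := ∑ j ∈ range (2 * n), 2 * B j ^ 2
  have h7 : n * ‖u R‖ ^ 2 ≤ (1 + |x|) * (2 * ‖u‖ ^ 2 + T * ‖g‖ ^ 2) := by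
    calc (n : ℝ) * ‖u R‖ ^ 2 ≤ ((1 + |x|) * S) * ‖u R‖ ^ 2 := by gcongr
      _ = (1 + |x|) * (S * ‖u R‖ ^ 2) := by ring
      _ ≤ (1 + |x|) * (2 * ‖u‖ ^ 2 + T * ‖g‖ ^ 2) := by
        gcongr
        linarith
  have h8 : 2 * (1 + |x|) ≤ η * n := by
    rw [div_lt_iff₀ hη] at hn
    linarith
  have h9 : n * ‖u R‖ ^ 2 ≤ n * (η * ‖u‖ ^ 2 + (1 + |x|) / n * T * ‖g‖ ^ 2) := by
    have : n * (η * ‖u‖ ^ 2 + (1 + |x|) / n * T * ‖g‖ ^ 2) =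
        (η * n) * ‖u‖ ^ 2 + (1 + |x|) * (T * ‖g‖ ^ 2) := by
      field_simp
    rw [this]
    nlinarith [sq_nonneg ‖u‖]
  exact le_of_mul_le_mul_left h9 hn0

/-! ### Truncated Jacobi matrices -/

/-- The truncations of `J - x` to the sites `≥ R`, with a Dirichlet condition at `R`, are bounded
below uniformly in `R` when `R` is large and starts a long stretch of entries `1`: removing the
small value at `R` turns `u` into an element of the domain of the full matrix, at a small cost. -/
theorem exists_uniform_bound {a : ℕ → ℝ} (x : ℝ) {n₀ : ℕ} {C : ℝ} (hC : 0 ≤ C)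
    (htail : ∀ u w : EllTwo ℕ, formalJacobi a (fun _ => 0) u = (w : ℕ → ℂ) →
      (∀ m < n₀, u m = 0) → ‖u‖ ≤ C * ‖w - (x : ℂ) • u‖) :
    ∃ ℓ : ℕ, ∃ C' : ℝ, 0 < C' ∧ ∀ R, n₀ ≤ R → (∀ i ≤ ℓ, a (R + i + 1) = 1) →
      ∀ u g : EllTwo ℕ, (∀ m < R, u m = 0) → (∀ m < R, g m = 0) →
        (∀ m, R ≤ m → formalJacobi a (fun _ => 0) u m - x * u m = g m) →
        ‖u‖ ≤ C' * ‖g‖ := by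
  classical
  set A : ℝ := C * (|x| + 1) + 1 with hA
  have hApos : 0 < A := by positivity
  obtain ⟨ℓ, K, hK, hstretch⟩ := exists_norm_sq_apply_le x (η := (1 / (2 * A)) ^ 2) (by positivity)
  refine ⟨ℓ + 1, 2 * (C + A * √K) + 1, by positivity, fun R hR ha u g hu hg hug => ?_⟩
  have hJ : ∀ m, R ≤ m → g m = (if m = R then 0 else (a m : ℂ) * u (m - 1)) +
      (a (m + 1) : ℂ) * u (m + 1) - x * u m := by
    intro m hm
    rw [← hug m hm, formalJacobi_apply]
    congr 2
    split_ifs with h1 h2 h2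
    · rfl
    · omega
    · rw [hu (m - 1) (by omega), mul_zero]
    · rfl
  have h0 : u (R + 1) = x * u R + g R := by
    rw [hJ R le_rfl, if_pos rfl, show R + 1 = R + 0 + 1 from rfl, ha 0 (by omega)]
    simp
  have hi : ∀ i < ℓ, u (R + (i + 2)) = x * u (R + (i + 1)) - u (R + i) + g (R + (i + 1)) := by
    intro i hi
    rw [hJ (R + (i + 1)) (by omega), if_neg (by omega), show R + (i + 1) + 1 = R + (i + 1) + 1 from
      rfl, ha (i + 1) (by omega), show R + (i + 1) = R + i + 1 from rfl, ha i (by omega)]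
    rw [show R + i + 1 - 1 = R + i by omega, show R + (i + 2) = R + i + 1 + 1 from rfl]
    push_cast
    ring
  -- The choice of `η` makes `A ‖u R‖` at most half of `‖u‖`, up to a multiple of `‖g‖`.
  have hsmall : ‖u R‖ ≤ 1 / (2 * A) * ‖u‖ + √K * ‖g‖ := by
    have h1 := hstretch R u g h0 hi
    refine le_of_sq_le_sq (h1.trans ?_) (by positivity)
    have h2 : (√K) ^ 2 = K := Real.sq_sqrt hK
    have h3 : 0 ≤ 1 / (2 * A) * ‖u‖ * (√K * ‖g‖) := by positivity
    nlinarith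
  let e : ℕ → EllTwo ℕ := fun m => lp.single 2 m (1 : ℂ)
  let v : EllTwo ℕ := u - (u R) • e R
  -- `w = J v`: removing the value at `R` changes `J u - x u` only at the sites `R` and `R + 1`.
  let w : EllTwo ℕ := (x : ℂ) • v + g + (x * u R) • e R - (u R) • e (R + 1)
  have he : ∀ i j, e i j = if j = i then 1 else 0 := fun i j => by
    change (lp.single 2 i (1 : ℂ) : EllTwo ℕ) j = _
    rw [lp.single_apply, Pi.single_apply]
  have hv : ∀ m, v m = if m = R then 0 else u m := by
    intro m
    change u m - u R * e R m = _
    rw [he]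
    split_ifs with h1
    · rw [h1]; ring
    · ring
  have hw : ∀ m, w m = x * v m + g m + x * u R * (if m = R then 1 else 0) -
      u R * (if m = R + 1 then 1 else 0) := by
    intro m
    rw [← he, ← he]
    rfl
  have hJv : formalJacobi a (fun _ => 0) v = (w : ℕ → ℂ) := by
    funext m
    rw [formalJacobi_apply, hw, hv, hv, hv]
    rcases lt_or_ge m R with hm | hm
    · rw [hg m hm, hu m hm, hu (m - 1) (by omega)]
      have h2 : (if m + 1 = R then 0 else u (m + 1)) = 0 := by
        split_ifs with h2
        · rfl
        · exact hu _ (by omega)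
      rw [h2, if_neg (by omega : m ≠ R), if_neg (by omega : m ≠ R),
        if_neg (by omega : m ≠ R + 1)]
      simp
    · rw [hJ m hm, if_neg (by omega : m + 1 ≠ R)]
      rcases eq_or_ne m R with rfl | hmR
      · have h2 : (if m = 0 then (0 : ℂ) else (a m : ℂ) *
            if m - 1 = m then 0 else u (m - 1)) = 0 := by
          split_ifs with h2 h3
          · rfl
          · simp
          · rw [hu _ (by omega), mul_zero]
        rw [h2]
        simp
      · rw [if_neg (by omega : m ≠ 0)]
        rcases eq_or_ne m (R + 1) with rfl | hmR1
        · have ha0 := ha 0 (by omega)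
          rw [add_zero] at ha0
          simp [ha0]
        · rw [if_neg (by omega : m - 1 ≠ R), if_neg hmR, if_neg hmR, if_neg hmR, if_neg hmR1]
          ring
  have hvtail : ∀ m < n₀, v m = 0 := by
    intro m hm
    rw [hv]
    split_ifs
    · rfl
    · exact hu m (by omega)
  have h1 := htail v w hJv hvtail
  have he1 : ∀ i, ‖e i‖ = 1 := fun i => by
    change ‖(lp.single 2 i (1 : ℂ) : EllTwo ℕ)‖ = 1
    rw [lp.norm_single (by simp), norm_one]
  have h2 : ‖w - (x : ℂ) • v‖ ≤ ‖g‖ + (|x| + 1) * ‖u R‖ := by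
    have : w - (x : ℂ) • v = g + (x * u R) • e R - (u R) • e (R + 1) := by
      simp only [w]; abel
    rw [this]
    refine (norm_sub_le _ _).trans ?_
    refine (add_le_add_left (norm_add_le _ _) _).trans ?_
    rw [norm_smul, norm_smul, he1, he1, norm_mul, Complex.norm_real, Real.norm_eq_abs]
    linarith
  have h3 : ‖u‖ ≤ ‖v‖ + ‖u R‖ := by
    have : u = v + (u R) • e R := by simp only [v]; abel
    calc ‖u‖ = ‖v + (u R) • e R‖ := by rw [← this]
      _ ≤ ‖v‖ + ‖(u R) • e R‖ := norm_add_le _ _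
      _ = ‖v‖ + ‖u R‖ := by rw [norm_smul, he1, mul_one]
  have h4 : ‖u‖ ≤ C * ‖g‖ + A * ‖u R‖ := by
    have := h1.trans (mul_le_mul_of_nonneg_left h2 hC)
    rw [hA]
    linarith
  have h5 : A * ‖u R‖ ≤ 1 / 2 * ‖u‖ + A * √K * ‖g‖ := by
    have := mul_le_mul_of_nonneg_left hsmall hApos.le
    have h6 : A * (1 / (2 * A) * ‖u‖ + √K * ‖g‖) = 1 / 2 * ‖u‖ + A * √K * ‖g‖ := by
      field_simp
    linarith
  nlinarith [norm_nonneg g]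

end Jacobi

/-! ### Comparison of the Laplacian with the Jacobi matrix -/

section Comparison

open scoped ENNReal

variable {V : Type*} {G : SimpleGraph V} [G.LocallyFinite] {O : V} {κ : ℕ → ℕ}

/-- A vector is no longer than its distance to any vector orthogonal to it. -/
theorem norm_le_norm_sub_of_mem_orthogonal {E : Type*} [NormedAddCommGroup E]
    [InnerProductSpace ℂ E] {N : Submodule ℂ E} {u v : E} (hu : u ∈ Nᗮ) (hv : v ∈ N) :
    ‖u‖ ≤ ‖u - v‖ := by
  have h1 := norm_sub_sq (𝕜 := ℂ) u v
  rw [(Submodule.mem_orthogonal' N u).1 hu v hv] at h1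
  refine le_of_sq_le_sq ?_ (norm_nonneg _)
  rw [h1]
  simp

/-- `radial` as an isometric embedding of `ℓ²(ℕ)` into `ℓ²(V)`. -/
noncomputable def radialIsometry (h : IsSphericallyHomogeneous G O κ) (hκ : ∀ j, κ j ≠ 0) :
    EllTwo ℕ →ₗᵢ[ℂ] EllTwo V where
  toFun u := ⟨radial G O κ u, memℓp_two_iff_sqSum.2 (by
    rw [sqSum_radial h hκ]; exact sqSum_coe_ne_top u)⟩
  map_add' u v := lp.ext (map_add (radial G O κ) (u : ℕ → ℂ) v)
  map_smul' c u := lp.ext (map_smul (radial G O κ) c (u : ℕ → ℂ))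
  norm_map' u := by
    rw [← sq_eq_sq₀ (norm_nonneg _) (norm_nonneg _), norm_sq_eq_toReal_sqSum,
      norm_sq_eq_toReal_sqSum]
    exact congrArg _ (sqSum_radial h hκ u)

/-- `component` as a contraction from `ℓ²(V)` to `ℓ²(ℕ)`. -/
noncomputable def componentL (h : IsSphericallyHomogeneous G O κ) (hκ : ∀ j, κ j ≠ 0) (y : V) :
    EllTwo V →L[ℂ] EllTwo ℕ :=
  have hle (f : EllTwo V) : sqSum (component G O κ y f) ≤ sqSum (f : V → ℂ) := by
    rw [← tsum_sqSum_component h hκ (sqSum_coe_ne_top f)]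
    exact ENNReal.le_tsum y
  LinearMap.mkContinuous
    { toFun := fun f => (⟨component G O κ y f, memℓp_two_iff_sqSum.2
        ((hle f).trans_lt (sqSum_coe_ne_top f).lt_top).ne⟩ : EllTwo ℕ)
      map_add' := fun f g => lp.ext (map_add (component G O κ y) (f : V → ℂ) g)
      map_smul' := fun c f => lp.ext (map_smul (component G O κ y) c (f : V → ℂ)) } 1 (fun f => by
    rw [one_mul]
    refine le_of_sq_le_sq ?_ (norm_nonneg _)
    rw [norm_sq_eq_toReal_sqSum, norm_sq_eq_toReal_sqSum]
    exact ENNReal.toReal_mono (sqSum_coe_ne_top f) (hle f))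

theorem coe_componentL (h : IsSphericallyHomogeneous G O κ) (hκ : ∀ j, κ j ≠ 0) (y : V)
    (f : EllTwo V) : (componentL h hκ y f : ℕ → ℂ) = component G O κ y f := rfl

/-- A bound for all components is a bound for the function, with the same constant. -/
theorem norm_le_of_componentL_le (h : IsSphericallyHomogeneous G O κ) (hκ : ∀ j, κ j ≠ 0)
    {C : ℝ} (hC : 0 ≤ C) {f g : EllTwo V}
    (hle : ∀ y, ‖componentL h hκ y f‖ ≤ C * ‖componentL h hκ y g‖) : ‖f‖ ≤ C * ‖g‖ := by
  have h1 : sqSum (f : V → ℂ) ≤ ENNReal.ofReal (C ^ 2) * sqSum (g : V → ℂ) := by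
    rw [← tsum_sqSum_component h hκ (sqSum_coe_ne_top f),
      ← tsum_sqSum_component h hκ (sqSum_coe_ne_top g), ← ENNReal.tsum_mul_left]
    refine ENNReal.tsum_le_tsum fun y => ?_
    rw [← coe_componentL h hκ, ← coe_componentL h hκ, sqSum_coe, sqSum_coe,
      ← ENNReal.ofReal_mul (sq_nonneg _), ← mul_pow]
    refine ENNReal.ofReal_le_ofReal ?_
    gcongr
    exact hle y
  rw [sqSum_coe, sqSum_coe, ← ENNReal.ofReal_mul (sq_nonneg _), ← mul_pow,
    ENNReal.ofReal_le_ofReal_iff (by positivity)] at h1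
  exact le_of_sq_le_sq h1 (by positivity)

/-- The radial functions are a copy of the Jacobi matrix inside the Laplacian. -/
theorem isFredholmAt_jacobi_of_laplacian (h : IsSphericallyHomogeneous G O κ)
    (hκ : ∀ j, κ j ≠ 0) (hone : ∀ N, ∃ n, N ≤ n ∧ κ n = 1)
    {a : ℕ → ℝ} (ha : ∀ j, a (j + 1) = √(κ j : ℝ)) {z : ℂ}
    (hF : IsFredholmAt (laplacian G) z) : IsFredholmAt (jacobi a (fun _ => 0)) z := by
  have hJ : HasGoodCutoffs (formalJacobi a (fun _ => 0)) (formalJacobi_support a (fun _ => 0))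
      (fun n : ℕ => n) := hasGoodCutoffs_jacobi fun N => by
    obtain ⟨n, hn, hκn⟩ := hone N
    exact ⟨n, hn, by rw [ha, hκn]; simp⟩
  obtain ⟨N, hN, C, hC, hle⟩ := (hasGoodCutoffs_laplacian h hone).exists_norm_sub_le hF
  let U := radialIsometry h hκ
  let Φ : EllTwo ℕ →L[ℂ] N := N.orthogonalProjectionOnto ∘L U.toContinuousLinearMap
  refine hJ.isFredholmAt_of_bound (M := LinearMap.ker Φ.toLinearMap) Φ.isClosed_ker
    (Submodule.CoFG.ker _) (inv_pos.2 hC) fun u w huw hu => ?_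
  have hUu : U u ∈ Nᗮ := by
    rw [← Submodule.ker_orthogonalProjectionOnto]
    exact hu
  have hUw : formalLaplacian G (U u) = (U w : V → ℂ) := by
    change formalLaplacian G (radial G O κ u) = radial G O κ w
    rw [laplacian_radial h hκ ha, huw]
  obtain ⟨v, hv, hUv⟩ := hle _ _ hUw
  rw [← map_smul, ← map_sub, U.norm_map] at hUv
  have h1 := (norm_le_norm_sub_of_mem_orthogonal hUu hv).trans hUv
  rw [U.norm_map] at h1
  rwa [inv_mul_le_iff₀ hC]

/-- The truncations of `J - x` are bounded below uniformly except at the finitely many vertices up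
to some level, and at each of those finitely many conditions on the component restore the bound. -/
theorem isFredholmAt_laplacian_of_jacobi (h : IsSphericallyHomogeneous G O κ)
    (hκ : ∀ j, κ j ≠ 0) (hone : ∀ N, ∃ n, N ≤ n ∧ κ n = 1)
    (hsparse : ∀ ℓ, ∃ n₀, ∀ n, n₀ ≤ n → κ n ≠ 1 → ∀ i ≤ ℓ, κ (n + 1 + i) = 1)
    {a : ℕ → ℝ} (ha : ∀ j, a (j + 1) = √(κ j : ℝ)) {x : ℝ}
    (hF : IsFredholmAt (jacobi a (fun _ => 0)) (x : ℂ)) :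
    IsFredholmAt (laplacian G) (x : ℂ) := by
  have hJ : HasGoodCutoffs (formalJacobi a (fun _ => 0)) (formalJacobi_support a (fun _ => 0))
      (fun n : ℕ => n) := hasGoodCutoffs_jacobi fun N => by
    obtain ⟨n, hn, hκn⟩ := hone N
    exact ⟨n, hn, by rw [ha, hκn]; simp⟩
  obtain ⟨N, hN, C, hC, hle⟩ := hJ.exists_norm_sub_le hF
  obtain ⟨n₀, htail⟩ := exists_bound_of_tail N hle
  obtain ⟨ℓ, C', hC', hunif⟩ := exists_uniform_bound x (by positivity) htail
  obtain ⟨n₁, hn₁⟩ := hsparse ℓ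
  let Y : Set V := {y | G.dist O y ≤ n₀ + n₁}
  have hY : Y.Finite := finite_dist_le h _
  have := hY.fintype
  let Φ : EllTwo V →L[ℂ] (Y → N × ℂ) := ContinuousLinearMap.pi fun y =>
    (N.orthogonalProjectionOnto.prod (lp.evalCLM ℂ (fun _ : ℕ => ℂ) 2 (G.dist O (y : V)))) ∘L
      componentL h hκ y
  have hmax : 0 < max C C' := lt_max_of_lt_left hC
  refine (hasGoodCutoffs_laplacian h hone).isFredholmAt_of_bound (M := LinearMap.ker Φ.toLinearMap)
    Φ.isClosed_ker (Submodule.CoFG.ker _) (inv_pos.2 hmax) fun f w hfw hf => ?_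
  rw [inv_mul_le_iff₀ hmax]
  refine norm_le_of_componentL_le h hκ hmax.le fun y => ?_
  set u := componentL h hκ y f with hu
  set g := componentL h hκ y (w - (x : ℂ) • f) with hg
  have hulow : ∀ m < G.dist O y, u m = 0 := fun m hm => component_of_lt _ y hm
  have hglow : ∀ m < G.dist O y, g m = 0 := fun m hm => component_of_lt _ y hm
  have hug : ∀ m, G.dist O y ≤ m → formalJacobi a (fun _ => 0) u m - x * u m = g m := by
    intro m hm
    have hw : componentL h hκ y w m = formalJacobi a (fun _ => 0) u m := by
      rw [coe_componentL, ← hfw]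
      exact component_laplacian h hκ ha f y hm
    rw [hg, map_sub, map_smul, lp.coeFn_sub, lp.coeFn_smul, Pi.sub_apply, Pi.smul_apply, hw]
    rfl
  by_cases hyY : G.dist O y ≤ n₀ + n₁
  · have hΦ : Φ f = 0 := hf
    have hΦy := congrFun hΦ (⟨y, hyY⟩ : Y)
    have huN : u ∈ Nᗮ := by
      rw [← Submodule.ker_orthogonalProjectionOnto]
      exact congrArg Prod.fst hΦy
    have hu0 : u (G.dist O y) = 0 := congrArg Prod.snd hΦy
    -- As `u` vanishes at its first site, `J u` has no contribution at the site before it.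
    have hJu : formalJacobi a (fun _ => 0) u = ((g + (x : ℂ) • u : EllTwo ℕ) : ℕ → ℂ) := by
      funext m
      rw [lp.coeFn_add, lp.coeFn_smul, Pi.add_apply, Pi.smul_apply, smul_eq_mul]
      rcases lt_or_ge m (G.dist O y) with hm | hm
      · rw [hglow m hm, hulow m hm, formalJacobi_apply, hulow (m - 1) (by omega)]
        have : u (m + 1) = 0 := by
          rcases eq_or_ne (m + 1) (G.dist O y) with h1 | h1
          · rw [h1, hu0]
          · exact hulow _ (by omega)
        rw [this]
        simp
      · rw [← hug m hm]
        ring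
    obtain ⟨v, hv, huv⟩ := hle _ _ hJu
    rw [add_sub_cancel_right] at huv
    exact ((norm_le_norm_sub_of_mem_orthogonal huN hv).trans huv).trans
      (mul_le_mul_of_nonneg_right (le_max_left _ _) (norm_nonneg _))
  · have hy : y ≠ O := by
      rintro rfl
      rw [SimpleGraph.dist_self] at hyY
      omega
    have hp := dist_parent h.isTree hy
    by_cases hκp : κ (G.dist O (parent G O y)) = 1
    · have : u = 0 := lp.ext (component_eq_zero h (mem_children_parent h.isTree hy) hκp f)
      rw [this, norm_zero]
      positivity
    · refine (hunif (G.dist O y) (by omega) (fun i hi => ?_) u g hulow hglow hug).trans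
        (mul_le_mul_of_nonneg_right (le_max_right _ _) (norm_nonneg _))
      rw [ha, hp, hn₁ _ (by omega) hκp i hi]
      simp

/-- Both operators are Fredholm at non-real `z`, and at real `z` the lower bounds transfer. -/
theorem isFredholmAt_laplacian_iff_jacobi (h : IsSphericallyHomogeneous G O κ)
    (hκ : ∀ j, κ j ≠ 0)
    (hsparse : ∀ ℓ, ∃ n₀, ∀ n, n₀ ≤ n → κ n ≠ 1 → ∀ i ≤ ℓ, κ (n + 1 + i) = 1)
    {a : ℕ → ℝ} (ha : ∀ j, a (j + 1) = √(κ j : ℝ)) (z : ℂ) :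
    IsFredholmAt (laplacian G) z ↔ IsFredholmAt (jacobi a (fun _ => 0)) z := by
  have hone : ∀ N, ∃ n, N ≤ n ∧ κ n = 1 := by
    intro N
    obtain ⟨n₀, hn₀⟩ := hsparse 0
    by_cases h1 : κ (max N n₀) = 1
    · exact ⟨_, le_max_left _ _, h1⟩
    · exact ⟨max N n₀ + 1 + 0, by omega, hn₀ _ (le_max_right _ _) h1 0 le_rfl⟩
  refine ⟨isFredholmAt_jacobi_of_laplacian h hκ hone ha, fun hF => ?_⟩
  by_cases hz : z.im = 0
  · obtain ⟨x, rfl⟩ : ∃ x : ℝ, (x : ℂ) = z := ⟨z.re, Complex.ext rfl (by simp [hz])⟩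
    exact isFredholmAt_laplacian_of_jacobi h hκ hone hsparse ha hF
  · exact (hasGoodCutoffs_laplacian h hone).isFredholmAt_of_im_ne_zero hz

end Comparison

/-! ### Branching numbers of sparse trees -/

theorem IsBranchingData.branching_apply {L k : ℕ → ℕ} (h : IsBranchingData L k) {n : ℕ}
    (hn : 1 ≤ n) : branching L k (L n) = k n := by
  have hex : ∃ m, 1 ≤ m ∧ L m = L n := ⟨n, hn, rfl⟩
  rw [branching, dif_pos hex]
  exact congrArg k (h.strictMonoOn.injOn hex.choose_spec.1 hn hex.choose_spec.2)

theorem exists_of_branching_ne_one {L k : ℕ → ℕ} {j : ℕ} (hj : branching L k j ≠ 1) :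
    ∃ n, 1 ≤ n ∧ L n = j := by
  by_contra hex
  exact hj (dif_neg hex)

theorem IsBranchingData.branching_ne_zero {L k : ℕ → ℕ} (h : IsBranchingData L k) (j : ℕ) :
    branching L k j ≠ 0 := by
  by_cases hj : branching L k j = 1
  · omega
  · obtain ⟨n, hn, rfl⟩ := exists_of_branching_ne_one hj
    rw [h.branching_apply hn]
    have := h.two_le n hn
    omega

theorem IsBranchingData.treeOffDiag_zero_succ {L k : ℕ → ℕ} (h : IsBranchingData L k) (j : ℕ) :
    treeOffDiag L k 0 (j + 1) = √(branching L k j : ℝ) := by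
  have hstart : ∀ m, 0 < m → startGen L m = L m + 1 := fun m hm => by
    obtain ⟨m, rfl⟩ := Nat.exists_eq_succ_of_ne_zero hm.ne'
    rfl
  by_cases hex : ∃ m, 0 < m ∧ startGen L m = startGen L 0 + (j + 1)
  · have hspec := hex.choose_spec
    rw [treeOffDiag, dif_pos hex]
    have hj : L hex.choose = j := by
      have h1 := hspec.2
      rw [hstart _ hspec.1] at h1
      have h0 : startGen L 0 = 0 := rfl
      omega
    rw [← h.branching_apply hspec.1, hj]
  · rw [treeOffDiag, dif_neg hex]
    have hj : branching L k j = 1 := by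
      by_contra hne
      obtain ⟨n, hn, hLn⟩ := exists_of_branching_ne_one hne
      refine hex ⟨n, hn, ?_⟩
      rw [hstart n hn, hLn]
      simp [startGen]
    simp [hj]

/-- In a sparse tree every branching level far from the root is followed by many levels without
branching. -/
theorem IsBranchingData.exists_branching_eq_one {L k : ℕ → ℕ} (h : IsBranchingData L k)
    (hsparse : Tendsto (fun n => L (n + 1) - L n) atTop atTop) (ℓ : ℕ) :
    ∃ n₀, ∀ j, n₀ ≤ j → branching L k j ≠ 1 → ∀ i ≤ ℓ, branching L k (j + 1 + i) = 1 := by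
  obtain ⟨m₀, hm₀⟩ := eventually_atTop.1 (hsparse.eventually_gt_atTop (ℓ + 1))
  refine ⟨L (m₀ + 1), fun j hj hne i hi => ?_⟩
  obtain ⟨n, hn, rfl⟩ := exists_of_branching_ne_one hne
  by_contra hne'
  obtain ⟨n', hn', hL⟩ := exists_of_branching_ne_one hne'
  have hmn : m₀ + 1 ≤ n := (h.strictMonoOn.le_iff_le (by simp) hn).1 hj
  have hlt : n < n' := (h.strictMonoOn.lt_iff_lt hn hn').1 (by omega)
  have h1 : L (n + 1) ≤ L n' := (h.strictMonoOn.le_iff_le (by simp) hn').2 hlt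
  have h2 := hm₀ n (by omega)
  omega

theorem mainTheorem9 {V : Type*} (G : SimpleGraph V) [G.LocallyFinite] (O : V) (L k : ℕ → ℕ)
    (hG : IsSparseTree G O L k)
    (hk : Tendsto k atTop atTop ∨ ∃ C : ℕ, ∀ n, 1 ≤ n → k n ≤ C) :
    essentialSpectrum (laplacian G) = essentialSpectrum (treeJacobi L k 0) := by
  obtain ⟨⟨hdata, hhom⟩, hsparse⟩ := hG
  ext z
  exact not_congr (isFredholmAt_laplacian_iff_jacobi hhom hdata.branching_ne_zero
    (hdata.exists_branching_eq_one hsparse) hdata.treeOffDiag_zero_succ z)
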